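/- Let $n\ge 1$, and write points of $\mathbb{R}^{n+1}_+=\mathbb{R}^n\times(0,\infty)$ as $(x,t)$. All functions below are finite arrays $F=(F_j)_j$ of measurable complex-valued functions on $\mathbb{R}^{n+1}_+$, with $|F|^2=\sum_j|F_j|^2$ and $$\langle F,G\rangle=\sum_j\int_{\mathbb{R}^{n+1}_+}\overline{F_j}\,G_j .$$ Let $B((y,s),r)$ be the Euclidean ball in $\mathbb{R}^{n+1}$, put $$A_F(y,s)=\Bigl(\frac1{|B((y,s),s/2)|}\int_{B((y,s),s/2)}|F|^2\Bigr)^{1/2}\qquad(y\in\mathbb{R}^n,\ s>0),$$ and for $x\in\mathbb{R}^n$ define $$\widetilde N_+F(x)=\sup\{A_F(y,s): s>0,\ |x-y|<s\},$$ $$\widetilde{\mathfrak C}_1^+F(x)=\sup_{Q\ni x}\frac1{|Q|}\int_Q\int_0^{\ell(Q)}A_F(y,s)\,\frac{ds\,dy}{s},$$ where the supremum is over cubes $Q\subset\mathbb{R}^n$ (with sides parallel to the axes) containing $x$ and $\ell(Q)$ is the side length of $Q$. Write $tH$ for the array $(x,t)\mapsto t\,H(x,t)$. Let $L^2_{loc}(\mathbb{R}^{n+1}_+)$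 be the space of arrays that are square integrable on each bounded open set $U$ with $\overline U\subset\mathbb{R}^{n+1}_+$, and let $L^2_c(\mathbb{R}^{n+1}_+)$ be the space of arrays $H\in L^2(\mathbb{R}^{n+1}_+)$ supported in some compact subset of $\mathbb{R}^{n+1}_+$ (depending on $H$). (a) For every $1<p<\infty$, with $1/p+1/p'=1$, there is a constant $C_p$ depending only on $n$ and $p$ such that for every $u\in L^2_{loc}(\mathbb{R}^{n+1}_+)$, $$\|\widetilde N_+u\|_{L^p(\mathbb{R}^n)}\le C_p\sup_{H\in L^2_c(\mathbb{R}^{n+1}_+)\setminus\{0\}}\frac{|\langle u,H\rangle|}{\|\widetilde{\mathfrak C}_1^+(tH)\|_{L^{p'}(\mathbb{R}^n)}},$$ provided the right-hand side is finite. (b) Conversely, there is a constant $C$ depending only on $n$ such that, whenever $1<p<\infty$, $1/p+1/p'=1$, $\widetilde N_+u\in L^p(\mathbb{R}^n)$ and $\widetilde{\mathfrak C}_1^+(tH)\in L^{p'}(\mathbb{R}^n)$, the integrals defining $\langle u,H\rangle$ converge absolutely and $$|\langle u,H\rangle|\le C\,\|\widetilde N_+u\|_{L^p(\mathbb{R}^n)}\,\|\widetilde{\mathfrak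 C}_1^+(tH)\|_{L^{p'}(\mathbb{R}^n)} .$$ -/

import Mathlib

open MeasureTheory Set
open scoped ENNReal NNReal

noncomputable section

namespace TentDuality

/-- The space `ℝⁿ × ℝ` of points `(x, t)`, carrying the product topology and Lebesgue measure.
(The product type is used for its coordinates; the distance of its metric structure is not the
Euclidean one, so Euclidean balls are written out in `euclBall`.) -/
abbrev Space (n : ℕ) : Type := EuclideanSpace ℝ (Fin n) × ℝ

/-- The open upper half-space `ℝⁿ × (0, ∞)`. -/
def upperHalfSpace (n : ℕ) : Set (Space n) := {X | 0 < X.2}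

/-- The open Euclidean ball `B((y, s), r)` in `ℝⁿ⁺¹`. -/
def euclBall {n : ℕ} (y : EuclideanSpace ℝ (Fin n)) (s r : ℝ) : Set (Space n) :=
  {X | Real.sqrt (dist X.1 y ^ 2 + (X.2 - s) ^ 2) < r}

/-- The open cube in `ℝⁿ`, with sides parallel to the axes, of lower corner `a` and side
length `ℓ`. -/
def cube {n : ℕ} (a : EuclideanSpace ℝ (Fin n)) (ℓ : ℝ) : Set (EuclideanSpace ℝ (Fin n)) :=
  {y | ∀ i, a i < y i ∧ y i < a i + ℓ}

variable {n : ℕ} {ι : Type} [Fintype ι]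

/-- The quadratic average `(⨍_{B((y,s),s/2)} |H|²)^{1/2}`. -/
def ballAverage (H : Space n → EuclideanSpace ℂ ι) (y : EuclideanSpace ℝ (Fin n)) (s : ℝ) :
    ℝ≥0∞ :=
  (⨍⁻ Z in euclBall y s (s / 2), ‖H Z‖ₑ ^ 2 ∂volume) ^ (1 / 2 : ℝ)

/-- The modified nontangential maximal function `Ñ₊ H`. -/
def modNT (H : Space n → EuclideanSpace ℂ ι) (x : EuclideanSpace ℝ (Fin n)) : ℝ≥0∞ :=
  ⨆ (y : EuclideanSpace ℝ (Fin n)) (s : ℝ) (_ : 0 < s) (_ : dist x y < s), ballAverage H y s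

/-- The averaged Carleson operator
`H ↦ sup_{Q ∋ x} |Q|⁻¹ ∫_Q ∫_0^{ℓ(Q)} (⨍_{B((y,s),s/2)} |H|²)^{1/2} ds/s dy`. -/
def avgCarleson (H : Space n → EuclideanSpace ℂ ι) (x : EuclideanSpace ℝ (Fin n)) : ℝ≥0∞ :=
  ⨆ (a : EuclideanSpace ℝ (Fin n)) (ℓ : ℝ) (_ : 0 < ℓ) (_ : x ∈ cube a ℓ),
    (volume (cube a ℓ))⁻¹ *
      ∫⁻ y in cube a ℓ, ∫⁻ s in Ioo 0 ℓ, ballAverage H y s / ENNReal.ofReal s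

/-- The array of functions `tH`, where `t` is the last coordinate function. -/
def tMul (H : Space n → EuclideanSpace ℂ ι) : Space n → EuclideanSpace ℂ ι :=
  fun X => (X.2 : ℂ) • H X

/-- The pairing `⟨F, G⟩ = ∑_j ∫_{ℝⁿ⁺¹₊} conj(F_j) G_j`. -/
def pairing (F G : Space n → EuclideanSpace ℂ ι) : ℂ :=
  ∑ j, ∫ X in upperHalfSpace n, starRingEnd ℂ (F X j) * G X j

/-- `u ∈ L²_loc(ℝⁿ⁺¹₊)`: square integrable on every bounded open set whose closure lies in the
open half-space. -/
def IsL2Loc (u : Space n → EuclideanSpace ℂ ι) : Prop :=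
  ∀ U : Set (Space n), IsOpen U → Bornology.IsBounded U → closure U ⊆ upperHalfSpace n →
    MemLp u 2 (volume.restrict U)

/-- `H ∈ L²_c(ℝⁿ⁺¹₊)`: square integrable, and zero (almost everywhere) off a compact subset of the
open half-space. -/
def IsL2c (H : Space n → EuclideanSpace ℂ ι) : Prop :=
  MemLp H 2 (volume.restrict (upperHalfSpace n)) ∧
    ∃ K : Set (Space n), IsCompact K ∧ K ⊆ upperHalfSpace n ∧
      ∀ᵐ X ∂volume.restrict (upperHalfSpace n), X ∉ K → H X = 0

/-- `sup |⟨u, H⟩| / ‖C̃₁⁺(tH)‖_{L^q(ℝⁿ)}` over all `H ∈ L²_c(ℝⁿ⁺¹₊) \ {0}`. -/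
def dualSup (q : ℝ) (u : Space n → EuclideanSpace ℂ ι) : ℝ≥0∞ :=
  ⨆ (H : Space n → EuclideanSpace ℂ ι) (_ : IsL2c H)
    (_ : ¬ H =ᵐ[volume.restrict (upperHalfSpace n)] 0),
    ‖pairing u H‖ₑ / eLpNorm (avgCarleson (tMul H)) (ENNReal.ofReal q) volume

end TentDuality

end

/-!
The theorem expresses a duality between the nontangential maximal function `Ñ₊ u` and the Carleson
function `C̃₁⁺(tH)`, where `u` and `H` enter only through the quadratic averages `A_u`, `A_{tH}`
over the Whitney balls `B((y,s),s/2)`.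

*Upper bound for the pairing.* Averaging over Whitney balls and the Cauchy–Schwarz inequality give
`∫ |u| |H| ≲ ∫ A_u A_{tH} dy ds / s` (`lintegral_upperHalfSpace_le`, `laverage_mul_le`). By
Carleson's embedding (`lintegral_mul_le_ntMax_mul_carlesonMax`) the right-hand side is at most a
multiple of `∫ Ñ₊u · C̃₁⁺(tH)`, to which Hölder's inequality applies. The embedding is proved on
level sets: if `A_u(y,s) > c`, then the whole ball `B(y,s)` lies in `{Ñ₊u > c}`, and a disjoint
Vitali subfamily of these balls carries Carleson boxes that cover `{A_u > c}`.

*Lower bound for the pairing.* By Lindelöf, `Ñ₊u` is the supremum of countably many step functions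
`A_k 1_{B(y_k,s_k)}`, where `A_k = A_u(y_k,s_k)` (`exists_seq_ntMax_eq`), so it suffices to bound
the maximum `N` of finitely many of them. Such a maximum equals `∑ A_k 1_{E_k}` with sets
`E_k ⊆ B(y_k,s_k)` that do not overlap. Put `h = N^{p-1}`, `w_k = ∫_{E_k} h`, and, with the Whitney
balls `B_k = B((y_k,s_k),s_k/2)`, take the test array `H = ∑ w_k / (|B_k| A_k) 1_{B_k} u`. Then
`⟨u, H⟩ = ∑ A_k w_k = ∫ N^p` (`enorm_pairing_testArray`). The Whitney balls that contribute to the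
box over a cube `Q` have `B(y_k,s_k)` in a fixed dilate of `Q`, and the contribution of each is at
most a multiple of `w_k`; hence `C̃₁⁺(tH)` is pointwise dominated by the Hardy–Littlewood maximal
function of `h` (`avgCarleson_testArray_le`). As `‖h‖_{p'} = ‖N‖_p^{p-1}`, the maximal inequality
(`lintegral_hlMax_rpow_le`) and a division by the finite quantity `‖N‖_p^{p-1}` complete the proof.
-/

noncomputable section

namespace TentDuality

open Metric Module
open scoped Pointwise

variable {n : ℕ}

/-! ### Euclidean balls of the half-space -/

lemma mem_euclBall_iff_mem_euclBall {y z : EuclideanSpace ℝ (Fin n)} {s t r : ℝ} :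
    ((z, t) : Space n) ∈ euclBall y s r ↔ ((y, s) : Space n) ∈ euclBall z t r := by
  simp only [euclBall, mem_ofPred_eq, dist_comm z y]
  rw [show (t - s) ^ 2 = (s - t) ^ 2 by ring]

lemma isOpen_euclBall (y : EuclideanSpace ℝ (Fin n)) (s r : ℝ) :
    IsOpen (euclBall y s r : Set (Space n)) :=
  isOpen_lt (by fun_prop) continuous_const

lemma measurableSet_euclBall (y : EuclideanSpace ℝ (Fin n)) (s r : ℝ) :
    MeasurableSet (euclBall y s r : Set (Space n)) :=
  (isOpen_euclBall y s r).measurableSet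

lemma measurableSet_upperHalfSpace : MeasurableSet (upperHalfSpace n) :=
  measurableSet_lt measurable_const measurable_snd

lemma dist_fst_lt_of_mem_euclBall {y : EuclideanSpace ℝ (Fin n)} {s r : ℝ} {X : Space n}
    (h : X ∈ euclBall y s r) : dist X.1 y < r :=
  lt_of_le_of_lt (Real.le_sqrt_of_sq_le (le_add_of_nonneg_right (sq_nonneg _))) h

lemma abs_snd_sub_lt_of_mem_euclBall {y : EuclideanSpace ℝ (Fin n)} {s r : ℝ} {X : Space n}
    (h : X ∈ euclBall y s r) : |X.2 - s| < r := by
  refine lt_of_le_of_lt (Real.le_sqrt_of_sq_le ?_) h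
  rw [sq_abs]
  exact le_add_of_nonneg_left (sq_nonneg _)

lemma half_lt_snd_of_mem_euclBall {y : EuclideanSpace ℝ (Fin n)} {s : ℝ} {X : Space n}
    (h : X ∈ euclBall y s (s / 2)) : s / 2 < X.2 := by
  have := abs_lt.1 (abs_snd_sub_lt_of_mem_euclBall h)
  linarith [this.1]

lemma snd_lt_of_mem_euclBall {y : EuclideanSpace ℝ (Fin n)} {s : ℝ} {X : Space n}
    (h : X ∈ euclBall y s (s / 2)) : X.2 < 3 * s / 2 := by
  have := abs_lt.1 (abs_snd_sub_lt_of_mem_euclBall h)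
  linarith [this.2]

lemma pos_of_mem_euclBall {y : EuclideanSpace ℝ (Fin n)} {s : ℝ} {X : Space n}
    (h : X ∈ euclBall y s (s / 2)) : 0 < s := by
  have := abs_nonneg (X.2 - s)
  linarith [abs_snd_sub_lt_of_mem_euclBall h]

lemma euclBall_subset_upperHalfSpace (y : EuclideanSpace ℝ (Fin n)) (s : ℝ) :
    euclBall y s (s / 2) ⊆ upperHalfSpace n := fun X hX => by
  have h1 := half_lt_snd_of_mem_euclBall hX
  have h2 := pos_of_mem_euclBall hX
  simp only [upperHalfSpace, mem_ofPred_eq]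
  linarith

lemma isBounded_euclBall (y : EuclideanSpace ℝ (Fin n)) (s r : ℝ) :
    Bornology.IsBounded (euclBall y s r : Set (Space n)) := by
  refine (Metric.isBounded_ball (x := ((y, s) : Space n)) (r := r)).subset fun X hX => ?_
  rw [Metric.mem_ball, Prod.dist_eq, max_lt_iff]
  exact ⟨dist_fst_lt_of_mem_euclBall hX, by
    rw [Real.dist_eq]; exact abs_snd_sub_lt_of_mem_euclBall hX⟩

lemma closure_euclBall_subset_upperHalfSpace (y : EuclideanSpace ℝ (Fin n)) {s : ℝ} (hs : 0 < s) :
    closure (euclBall y s (s / 2)) ⊆ upperHalfSpace n := by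
  have h : closure (euclBall y s (s / 2)) ⊆ {X : Space n | s / 2 ≤ X.2} :=
    closure_minimal (fun X hX => (half_lt_snd_of_mem_euclBall hX).le)
      (isClosed_le continuous_const continuous_snd)
  intro X hX
  have := h hX
  simp only [mem_ofPred_eq, upperHalfSpace] at this ⊢
  linarith

instance isAddHaarMeasure_volume_space : (volume : Measure (Space n)).IsAddHaarMeasure :=
  inferInstanceAs (Measure.prod volume volume).IsAddHaarMeasure

/-- The Lebesgue measure of the Euclidean unit ball of `ℝⁿ⁺¹`. -/
def unitBallVolume (n : ℕ) : ℝ≥0∞ := volume (euclBall (0 : EuclideanSpace ℝ (Fin n)) 0 1)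

lemma unitBallVolume_ne_top : unitBallVolume n ≠ ∞ :=
  (isBounded_euclBall (0 : EuclideanSpace ℝ (Fin n)) 0 1).measure_lt_top.ne

lemma unitBallVolume_ne_zero : unitBallVolume n ≠ 0 :=
  ((isOpen_euclBall (0 : EuclideanSpace ℝ (Fin n)) 0 1).measure_pos volume
    ⟨0, by simp [euclBall]⟩).ne'

lemma volume_euclBall (y : EuclideanSpace ℝ (Fin n)) (s : ℝ) {r : ℝ} (hr : 0 < r) :
    volume (euclBall y s r : Set (Space n)) = ENNReal.ofReal (r ^ (n + 1)) * unitBallVolume n := by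
  have h1 : euclBall y s r = (fun X : Space n => (-((y, s) : Space n)) + X) ⁻¹'
      (r • (euclBall (0 : EuclideanSpace ℝ (Fin n)) 0 1)) := by
    ext X
    rw [mem_preimage, mem_smul_set_iff_inv_smul_mem₀ hr.ne']
    simp only [euclBall, mem_ofPred_eq, Prod.smul_fst, Prod.smul_snd, Prod.fst_add, Prod.snd_add,
      Prod.fst_neg, Prod.snd_neg, sub_zero, dist_zero_right, norm_smul, smul_eq_mul]
    rw [dist_eq_norm, neg_add_eq_sub, neg_add_eq_sub,
      show (‖r⁻¹‖ * ‖X.1 - y‖) ^ 2 + (r⁻¹ * (X.2 - s)) ^ 2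
        = (r⁻¹) ^ 2 * (‖X.1 - y‖ ^ 2 + (X.2 - s) ^ 2) by
        rw [mul_pow, Real.norm_eq_abs, sq_abs]; ring,
      Real.sqrt_mul (by positivity), Real.sqrt_sq (by positivity), inv_mul_lt_iff₀ hr, mul_one]
  rw [h1, measure_preimage_add, Measure.addHaar_smul]
  simp [unitBallVolume, abs_of_pos hr]

lemma volume_euclBall_ne_zero (y : EuclideanSpace ℝ (Fin n)) (s : ℝ) {r : ℝ} (hr : 0 < r) :
    volume (euclBall y s r : Set (Space n)) ≠ 0 := by
  rw [volume_euclBall y s hr]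
  exact mul_ne_zero (ENNReal.ofReal_pos.2 (by positivity)).ne' unitBallVolume_ne_zero

lemma volume_euclBall_ne_top (y : EuclideanSpace ℝ (Fin n)) (s r : ℝ) :
    volume (euclBall y s r : Set (Space n)) ≠ ∞ :=
  (isBounded_euclBall y s r).measure_lt_top.ne

/-! ### Cubes -/

lemma isOpen_cube (a : EuclideanSpace ℝ (Fin n)) (ℓ : ℝ) : IsOpen (cube a ℓ) := by
  have : cube a ℓ = ⋂ i, {y : EuclideanSpace ℝ (Fin n) | a i < y i ∧ y i < a i + ℓ} := by
    ext y; simp [cube]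
  rw [this]
  refine isOpen_iInter_of_finite fun i => ?_
  have hc : Continuous fun y : EuclideanSpace ℝ (Fin n) => y i := by fun_prop
  exact (isOpen_lt continuous_const hc).inter (isOpen_lt hc continuous_const)

lemma dist_lt_of_mem_cube (hn : 1 ≤ n) {a x y : EuclideanSpace ℝ (Fin n)} {ℓ : ℝ}
    (hx : x ∈ cube a ℓ) (hy : y ∈ cube a ℓ) : dist x y < n * ℓ := by
  have h0 : ∀ i, |x i - y i| < ℓ := fun i => by
    have h1 := hx i
    have h2 := hy i
    rw [abs_lt]; constructor <;> linarith
  have hℓ : 0 < ℓ := (abs_nonneg _).trans_lt (h0 ⟨0, hn⟩)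
  have hn' : (1 : ℝ) ≤ n := by exact_mod_cast hn
  rw [EuclideanSpace.dist_eq, Real.sqrt_lt' (by positivity)]
  calc ∑ i, dist (x i) (y i) ^ 2 < ∑ _i : Fin n, ℓ ^ 2 := by
        refine Finset.sum_lt_sum_of_nonempty ⟨⟨0, hn⟩, Finset.mem_univ _⟩ fun i _ => ?_
        rw [Real.dist_eq]
        exact pow_lt_pow_left₀ (h0 i) (abs_nonneg _) two_ne_zero
    _ = n * ℓ ^ 2 := by simp
    _ ≤ (n * ℓ) ^ 2 := by nlinarith [sq_nonneg ℓ]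

lemma volume_cube (a : EuclideanSpace ℝ (Fin n)) {ℓ : ℝ} :
    volume (cube a ℓ) = ENNReal.ofReal ℓ ^ n := by
  have h : cube a ℓ = (WithLp.ofLp : EuclideanSpace ℝ (Fin n) → Fin n → ℝ) ⁻¹'
      (Set.univ.pi fun i => Ioo (a i) (a i + ℓ)) := by
    ext y; simp [cube]
  rw [h, (PiLp.volume_preserving_ofLp (Fin n)).measure_preimage
    (MeasurableSet.univ_pi fun _ => measurableSet_Ioo).nullMeasurableSet, Real.volume_pi_Ioo]
  simp

lemma volume_ball_eq (x : EuclideanSpace ℝ (Fin n)) {r : ℝ} (hr : 0 < r) :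
    volume (ball x r) = ENNReal.ofReal (r ^ n)
      * volume (ball (0 : EuclideanSpace ℝ (Fin n)) 1) := by
  rw [Measure.addHaar_ball_of_pos _ _ hr, finrank_euclideanSpace_fin]

/-! ### Quadratic averages -/

/-- The quadratic average over `B((y,s),s/2)` of a scalar function with values in `[0, ∞]`. -/
def quadAverage (f : Space n → ℝ≥0∞) (y : EuclideanSpace ℝ (Fin n)) (s : ℝ) : ℝ≥0∞ :=
  (⨍⁻ Z in euclBall y s (s / 2), f Z ^ 2 ∂volume) ^ (1 / 2 : ℝ)

lemma ballAverage_eq_quadAverage {ι : Type} [Fintype ι] (H : Space n → EuclideanSpace ℂ ι)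
    (y : EuclideanSpace ℝ (Fin n)) (s : ℝ) :
    ballAverage H y s = quadAverage (fun Z => ‖H Z‖ₑ) y s := rfl

lemma quadAverage_congr_ae {f g : Space n → ℝ≥0∞}
    (h : f =ᵐ[volume.restrict (upperHalfSpace n)] g) (y : EuclideanSpace ℝ (Fin n)) (s : ℝ) :
    quadAverage f y s = quadAverage g y s := by
  unfold quadAverage
  congr 1
  refine laverage_congr ?_
  filter_upwards [ae_mono (Measure.restrict_mono (euclBall_subset_upperHalfSpace y s) le_rfl) h]
    with Z hZ
  rw [hZ]

lemma measurable_setLIntegral_euclBall {f : Space n → ℝ≥0∞} (hf : Measurable f) :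
    Measurable fun P : Space n => ∫⁻ Z in euclBall P.1 P.2 (P.2 / 2), f Z := by
  have hS : MeasurableSet {R : Space n × Space n | R.2 ∈ euclBall R.1.1 R.1.2 (R.1.2 / 2)} := by
    simp only [euclBall, mem_ofPred_eq]
    exact (isOpen_lt (by fun_prop) (by fun_prop)).measurableSet
  have : (fun P : Space n => ∫⁻ Z in euclBall P.1 P.2 (P.2 / 2), f Z) = fun P : Space n =>
      ∫⁻ Z, {R : Space n × Space n | R.2 ∈ euclBall R.1.1 R.1.2 (R.1.2 / 2)}.indicator
        (fun R => f R.2) (P, Z) := by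
    ext P
    rw [← lintegral_indicator (measurableSet_euclBall _ _ _)]
    rfl
  rw [this]
  exact ((hf.comp measurable_snd).indicator hS).lintegral_prod_right'

lemma measurable_volume_euclBall :
    Measurable fun P : Space n => volume (euclBall P.1 P.2 (P.2 / 2) : Set (Space n)) := by
  simpa using measurable_setLIntegral_euclBall (n := n) (f := fun _ => 1) measurable_const

lemma measurable_quadAverage {f : Space n → ℝ≥0∞} (hf : Measurable f) :
    Measurable fun P : Space n => quadAverage f P.1 P.2 := by
  simp only [quadAverage, setLAverage_eq]
  exact ((measurable_setLIntegral_euclBall (hf.pow_const 2)).div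
    measurable_volume_euclBall).pow_const _

/-- The Cauchy–Schwarz inequality for averages over `B((y,s),s/2)`. -/
lemma laverage_mul_le_quadAverage_mul {f g : Space n → ℝ≥0∞} (hf : Measurable f)
    (hg : Measurable g) (y : EuclideanSpace ℝ (Fin n)) (s : ℝ) :
    ⨍⁻ Z in euclBall y s (s / 2), f Z * g Z ∂volume ≤ quadAverage f y s * quadAverage g y s := by
  have := ENNReal.lintegral_mul_le_Lp_mul_Lq
    ((volume.restrict (euclBall y s (s / 2)) univ)⁻¹ • volume.restrict (euclBall y s (s / 2)))
    Real.HolderConjugate.two_two hf.aemeasurable hg.aemeasurable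
  simpa [quadAverage, laverage] using this

lemma quadAverage_add_le {f g : Space n → ℝ≥0∞} (hf : Measurable f) (hg : Measurable g)
    (y : EuclideanSpace ℝ (Fin n)) (s : ℝ) :
    quadAverage (fun Z => f Z + g Z) y s ≤ quadAverage f y s + quadAverage g y s := by
  have := ENNReal.lintegral_Lp_add_le (p := 2)
    (μ := (volume.restrict (euclBall y s (s / 2)) univ)⁻¹ • volume.restrict (euclBall y s (s / 2)))
    hf.aemeasurable hg.aemeasurable one_le_two
  simpa [quadAverage, laverage] using this

lemma quadAverage_zero (y : EuclideanSpace ℝ (Fin n)) (s : ℝ) :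
    quadAverage (fun _ => 0) y s = 0 := by
  simp [quadAverage]

lemma quadAverage_const_mul {f : Space n → ℝ≥0∞} (hf : Measurable f) (c : ℝ≥0∞)
    (y : EuclideanSpace ℝ (Fin n)) (s : ℝ) :
    quadAverage (fun Z => c * f Z) y s = c * quadAverage f y s := by
  have h2 : (c ^ 2) ^ (1 / 2 : ℝ) = c := by
    rw [← ENNReal.rpow_natCast, ← ENNReal.rpow_mul]; simp
  simp only [quadAverage, mul_pow, laverage]
  rw [lintegral_const_mul _ (hf.pow_const 2), ENNReal.mul_rpow_of_nonneg _ _ (by norm_num), h2]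

lemma quadAverage_sum_le {κ : Type*} (S : Finset κ) {f : κ → Space n → ℝ≥0∞}
    (hf : ∀ k, Measurable (f k)) (y : EuclideanSpace ℝ (Fin n)) (s : ℝ) :
    quadAverage (fun Z => ∑ k ∈ S, f k Z) y s ≤ ∑ k ∈ S, quadAverage (f k) y s := by
  classical
  induction S using Finset.induction_on with
  | empty => simp [quadAverage_zero]
  | insert k S hk ih =>
    simp only [Finset.sum_insert hk]
    exact (quadAverage_add_le (hf k) (Finset.measurable_fun_sum S fun k _ => hf k) y s).trans
      (by gcongr)

/-- Averaging over Whitney balls and integrating over the half-space dominates the integral. -/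
lemma lintegral_upperHalfSpace_le {f : Space n → ℝ≥0∞} (hf : Measurable f) :
    ∫⁻ Z in upperHalfSpace n, f Z ≤ ENNReal.ofReal ((5 / 2) ^ (n + 1)) *
      ∫⁻ P in upperHalfSpace n, ⨍⁻ Z in euclBall P.1 P.2 (P.2 / 2), f Z ∂volume := by
  set C : ℝ≥0∞ := ENNReal.ofReal ((5 / 2) ^ (n + 1))
  set V : Space n → ℝ≥0∞ := fun P => (volume (euclBall P.1 P.2 (P.2 / 2) : Set (Space n)))⁻¹
  have hV : Measurable V := measurable_volume_euclBall.inv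
  set S : Set (Space n × Space n) := {R | R.2 ∈ euclBall R.1.1 R.1.2 (R.1.2 / 2)}
  have hS : MeasurableSet S := by
    simp only [S, euclBall, mem_ofPred_eq]
    exact (isOpen_lt (by fun_prop) (by fun_prop)).measurableSet
  -- The measure of the set of balls containing `Z`, each weighted by the inverse of its volume.
  have key : ∀ Z ∈ upperHalfSpace n,
      1 ≤ C * ∫⁻ P in upperHalfSpace n, S.indicator (fun R => V R.1) (P, Z) := by
    intro Z hZ
    have ht : 0 < Z.2 := hZ
    set t := Z.2 with ht'
    -- A point `P` within `t / 4` of `Z` has height in `(3t/4, 5t/4)`, so its Whitney ball contains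
    -- `Z` and has radius at most `5t/8`; the ratio of the radii `5t/8` and `t/4` is `5/2`.
    set B : Set (Space n) := euclBall Z.1 t (t / 4)
    have hB : ∀ P ∈ B, P ∈ upperHalfSpace n ∧ (P, Z) ∈ S ∧
        (ENNReal.ofReal ((5 * t / 8) ^ (n + 1)) * unitBallVolume n)⁻¹ ≤ V P := by
      intro P hP
      have h1 := abs_lt.1 (abs_snd_sub_lt_of_mem_euclBall hP)
      have hP0 : 0 < P.2 := by linarith [h1.1]
      refine ⟨hP0, ?_, ?_⟩
      · have h2 : Z ∈ euclBall P.1 P.2 (t / 4) := mem_euclBall_iff_mem_euclBall.2 hP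
        simp only [euclBall, mem_ofPred_eq, S] at h2 ⊢
        linarith [h1.1]
      · simp only [V]
        rw [volume_euclBall _ _ (by linarith : 0 < P.2 / 2)]
        gcongr (ENNReal.ofReal (?_ ^ _) * _)⁻¹
        linarith [h1.2]
    calc (1 : ℝ≥0∞) = C * ((ENNReal.ofReal ((5 * t / 8) ^ (n + 1)) * unitBallVolume n)⁻¹
          * volume B) := by
          have e : ENNReal.ofReal ((5 * t / 8) ^ (n + 1)) * unitBallVolume n = C * volume B := by
            rw [volume_euclBall _ _ (by linarith : 0 < t / 4), ← mul_assoc,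
              ← ENNReal.ofReal_mul (by positivity), ← mul_pow]
            congr 3; ring
          rw [e, mul_left_comm, ENNReal.inv_mul_cancel]
          · exact mul_ne_zero (ENNReal.ofReal_pos.2 (by positivity)).ne'
              (volume_euclBall_ne_zero _ _ (by linarith))
          · exact ENNReal.mul_ne_top ENNReal.ofReal_ne_top (volume_euclBall_ne_top _ _ _)
      _ ≤ C * ∫⁻ P in B, S.indicator (fun R => V R.1) (P, Z) := by
          gcongr
          rw [← setLIntegral_const]
          refine setLIntegral_mono' (measurableSet_euclBall _ _ _) fun P hP => ?_
          rw [indicator_of_mem (hB P hP).2.1]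
          exact (hB P hP).2.2
      _ ≤ _ := by
          gcongr
          exact fun P hP => (hB P hP).1
  calc ∫⁻ Z in upperHalfSpace n, f Z
      ≤ ∫⁻ Z in upperHalfSpace n, f Z *
        (C * ∫⁻ P in upperHalfSpace n, S.indicator (fun R => V R.1) (P, Z)) := by
        refine setLIntegral_mono' measurableSet_upperHalfSpace fun Z hZ => ?_
        exact le_mul_of_one_le_right' (key Z hZ)
    _ ≤ ∫⁻ Z, f Z *
        (C * ∫⁻ P in upperHalfSpace n, S.indicator (fun R => V R.1) (P, Z)) :=
        setLIntegral_le_lintegral _ _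
    _ = C * ∫⁻ Z, ∫⁻ P in upperHalfSpace n, f Z * S.indicator (fun R => V R.1) (P, Z) := by
        have hm : Measurable (S.indicator (fun R => V R.1)) :=
          (hV.comp measurable_fst).indicator hS
        rw [← lintegral_const_mul]
        · refine lintegral_congr fun Z => ?_
          rw [mul_left_comm, lintegral_const_mul _
            (show Measurable fun P => S.indicator (fun R => V R.1) (P, Z) from
              hm.comp (measurable_id.prodMk measurable_const))]
        · exact Measurable.lintegral_prod_left'
            (f := fun R : Space n × Space n => f R.2 * S.indicator (fun R => V R.1) R)
            ((hf.comp measurable_snd).mul hm)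
    _ = C * ∫⁻ P in upperHalfSpace n, ∫⁻ Z, f Z * S.indicator (fun R => V R.1) (P, Z) := by
        rw [lintegral_lintegral_swap]
        exact ((hf.comp measurable_fst).mul (((hV.comp measurable_fst).indicator hS).comp
          measurable_swap)).aemeasurable
    _ = _ := by
        congr 1
        refine lintegral_congr fun P => ?_
        rw [setLAverage_eq, ENNReal.div_eq_inv_mul, ← lintegral_const_mul _ hf,
          ← lintegral_indicator (measurableSet_euclBall _ _ _)]
        refine lintegral_congr fun Z => ?_
        by_cases h : Z ∈ euclBall P.1 P.2 (P.2 / 2)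
        · rw [indicator_of_mem h, indicator_of_mem (show (P, Z) ∈ S from h), mul_comm]
        · rw [indicator_of_notMem h, indicator_of_notMem (show (P, Z) ∉ S from h), mul_zero]

/-! ### Covering and level sets -/

/-- Vitali's covering lemma for balls of `ℝⁿ`, in the form used for both level set estimates. -/
lemma exists_countable_disjoint_balls (t : Set (EuclideanSpace ℝ (Fin n) × ℝ))
    (ht : ∀ a ∈ t, 0 < a.2) (R : ℝ) (hR : ∀ a ∈ t, a.2 ≤ R) :
    ∃ u ⊆ t, u.Countable ∧ (u.PairwiseDisjoint fun a => ball a.1 a.2) ∧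
      ∀ a ∈ t, ∃ b ∈ u, dist a.1 b.1 < 3 * b.2 ∧ a.2 ≤ 2 * b.2 := by
  obtain ⟨u, hut, hdisj, hu⟩ := Vitali.exists_disjoint_subfamily_covering_enlargement
    (fun a : EuclideanSpace ℝ (Fin n) × ℝ => ball a.1 a.2) t (fun a => a.2) 2 one_lt_two
    (fun a ha => (ht a ha).le) R hR (fun a ha => ⟨a.1, mem_ball_self (ht a ha)⟩)
  refine ⟨u, hut, hdisj.countable_of_isOpen (fun _ _ => isOpen_ball)
    (fun a ha => ⟨a.1, mem_ball_self (ht a (hut ha))⟩), hdisj, fun a ha => ?_⟩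
  obtain ⟨b, hb, ⟨z, hza, hzb⟩, hab⟩ := hu a ha
  refine ⟨b, hb, ?_, hab⟩
  rw [mem_ball] at hza hzb
  have := dist_triangle_left a.1 b.1 z
  linarith

/-- Balls in `ℝⁿ`, `n ≥ 1`, of bounded volume have bounded radii. -/
lemma exists_radius_bound (hn : 1 ≤ n) {V : ℝ≥0∞} (hV : V ≠ ∞) :
    ∃ R : ℝ, ∀ (y : EuclideanSpace ℝ (Fin n)) (r : ℝ), 0 < r → volume (ball y r) ≤ V → r ≤ R := by
  set v := volume (ball (0 : EuclideanSpace ℝ (Fin n)) 1)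
  have hv0 : v ≠ 0 := (measure_ball_pos volume _ one_pos).ne'
  have hvt : v ≠ ∞ := measure_ball_lt_top.ne
  refine ⟨max 1 (V / v).toReal, fun y r hr h => ?_⟩
  by_cases h1 : r ≤ 1
  · exact h1.trans (le_max_left _ _)
  refine le_max_of_le_right ?_
  rw [volume_ball_eq y hr] at h
  have h2 : ENNReal.ofReal (r ^ n) ≤ V / v := by
    rwa [ENNReal.le_div_iff_mul_le (Or.inl hv0) (Or.inl hvt)]
  have h3 := (ENNReal.ofReal_le_iff_le_toReal (ENNReal.div_ne_top hV hv0)).1 h2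
  exact (le_self_pow₀ (not_le.1 h1).le (by omega)).trans h3

/-- The layer cake formula for functions with values in `[0, ∞]`. -/
lemma lintegral_rpow_eq_layercake {α : Type*} [MeasurableSpace α] {μ : Measure α} {f : α → ℝ≥0∞}
    (hf : AEMeasurable f μ) (hfin : ∀ᵐ x ∂μ, f x ≠ ∞) {p : ℝ} (hp : 0 < p) :
    ∫⁻ x, f x ^ p ∂μ = ENNReal.ofReal p *
      ∫⁻ t in Ioi (0 : ℝ), μ {x | ENNReal.ofReal t < f x} * ENNReal.ofReal (t ^ (p - 1)) := by
  have h := lintegral_rpow_eq_lintegral_meas_lt_mul μ (f := fun x => (f x).toReal)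
    (Filter.Eventually.of_forall fun _ => ENNReal.toReal_nonneg) hf.ennreal_toReal hp
  have e : ∫⁻ x, f x ^ p ∂μ = ∫⁻ x, ENNReal.ofReal ((f x).toReal ^ p) ∂μ := by
    refine lintegral_congr_ae ?_
    filter_upwards [hfin] with x hx
    rw [← ENNReal.ofReal_rpow_of_nonneg ENNReal.toReal_nonneg hp.le, ENNReal.ofReal_toReal hx]
  rw [e, h]
  congr 1
  refine setLIntegral_congr_fun measurableSet_Ioi fun t ht => ?_
  congr 1
  refine measure_congr ?_
  filter_upwards [hfin] with x hx
  exact propext (ENNReal.ofReal_lt_iff_lt_toReal (le_of_lt ht) hx).symm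

lemma lintegral_eq_layercake {α : Type*} [MeasurableSpace α] {μ : Measure α} {f : α → ℝ≥0∞}
    (hf : AEMeasurable f μ) (hfin : ∀ᵐ x ∂μ, f x ≠ ∞) :
    ∫⁻ x, f x ∂μ = ∫⁻ t in Ioi (0 : ℝ), μ {x | ENNReal.ofReal t < f x} := by
  simpa using lintegral_rpow_eq_layercake hf hfin one_pos

/-! ### The Carleson embedding -/

/-- The nontangential maximal function of a function on the half-space. -/
def ntMax (g : Space n → ℝ≥0∞) (x : EuclideanSpace ℝ (Fin n)) : ℝ≥0∞ :=
  ⨆ (y : EuclideanSpace ℝ (Fin n)) (s : ℝ) (_ : 0 < s) (_ : dist x y < s), g (y, s)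

/-- The Carleson function of the measure with density `m` on the half-space. -/
def carlesonMax (m : Space n → ℝ≥0∞) (x : EuclideanSpace ℝ (Fin n)) : ℝ≥0∞ :=
  ⨆ (a : EuclideanSpace ℝ (Fin n)) (ℓ : ℝ) (_ : 0 < ℓ) (_ : x ∈ cube a ℓ),
    (volume (cube a ℓ))⁻¹ * ∫⁻ y in cube a ℓ, ∫⁻ s in Ioo 0 ℓ, m (y, s)

lemma le_ntMax (g : Space n → ℝ≥0∞) {x y : EuclideanSpace ℝ (Fin n)} {s : ℝ} (hs : 0 < s)
    (h : dist x y < s) : g (y, s) ≤ ntMax g x :=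
  le_iSup_of_le y <| le_iSup_of_le s <| le_iSup_of_le hs <| le_iSup_of_le h le_rfl

lemma lt_ntMax_iff {g : Space n → ℝ≥0∞} {x : EuclideanSpace ℝ (Fin n)} {c : ℝ≥0∞} :
    c < ntMax g x ↔ ∃ y s, 0 < s ∧ dist x y < s ∧ c < g (y, s) := by
  simp only [ntMax, lt_iSup_iff, exists_prop]

lemma lowerSemicontinuous_ntMax (g : Space n → ℝ≥0∞) : LowerSemicontinuous (ntMax g) := by
  refine lowerSemicontinuous_iff_isOpen_preimage.2 fun c => ?_
  rw [Metric.isOpen_iff]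
  intro x hx
  obtain ⟨y, s, hs, hxy, hc⟩ := lt_ntMax_iff.1 hx
  refine ⟨s - dist x y, by linarith, fun z hz => ?_⟩
  rw [mem_ball] at hz
  exact lt_ntMax_iff.2 ⟨y, s, hs, by linarith [dist_triangle z x y], hc⟩

lemma lowerSemicontinuous_carlesonMax (m : Space n → ℝ≥0∞) :
    LowerSemicontinuous (carlesonMax m) := by
  refine lowerSemicontinuous_iff_isOpen_preimage.2 fun c => ?_
  rw [isOpen_iff_mem_nhds]
  intro x hx
  simp only [carlesonMax, mem_preimage, mem_Ioi, lt_iSup_iff] at hx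
  obtain ⟨a, ℓ, hℓ, hxQ, hc⟩ := hx
  filter_upwards [(isOpen_cube a ℓ).mem_nhds hxQ] with z hz
  exact hc.trans_le <| le_iSup_of_le a <| le_iSup_of_le ℓ <| le_iSup_of_le hℓ <|
    le_iSup_of_le hz le_rfl

/-- The constant of the Carleson embedding: the ratio of the volume of a cube of side length `8` to
that of a unit ball. -/
def embedConst (n : ℕ) : ℝ≥0∞ :=
  ENNReal.ofReal 8 ^ n / volume (ball (0 : EuclideanSpace ℝ (Fin n)) 1)

lemma embedConst_ne_top : embedConst n ≠ ∞ :=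
  ENNReal.div_ne_top (by finiteness) (measure_ball_pos volume _ one_pos).ne'

/-- A Carleson box over a cube concentric with a ball is controlled by the Carleson function on that
ball. -/
lemma lintegral_box_le {m : Space n → ℝ≥0∞} (z : EuclideanSpace ℝ (Fin n)) {r : ℝ} (hr : 0 < r) :
    ∫⁻ y in ball z (3 * r), ∫⁻ s in Ioo 0 (8 * r), m (y, s)
      ≤ embedConst n * ∫⁻ x in ball z r, carlesonMax m x := by
  set a : EuclideanSpace ℝ (Fin n) := WithLp.toLp 2 fun i => z i - 4 * r
  have hsub : ball z (3 * r) ⊆ cube a (8 * r) := by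
    intro y hy i
    rw [mem_ball, dist_eq_norm] at hy
    have h := abs_lt.1 ((PiLp.norm_apply_le (y - z) i).trans_lt hy)
    simp only [PiLp.sub_apply] at h
    simp only [a]
    constructor <;> linarith [h.1, h.2]
  have hvol : volume (cube a (8 * r)) = embedConst n * volume (ball z r) := by
    rw [volume_cube, volume_ball_eq z hr, embedConst, mul_left_comm, ENNReal.div_mul_cancel
      (measure_ball_pos volume _ one_pos).ne' measure_ball_lt_top.ne,
      ENNReal.ofReal_mul (by norm_num), mul_pow, mul_comm, ENNReal.ofReal_pow hr.le]
  have h8 : 0 < 8 * r := by positivity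
  have hQ0 : volume (cube a (8 * r)) ≠ 0 := by
    rw [volume_cube]; exact pow_ne_zero _ (ENNReal.ofReal_pos.2 h8).ne'
  have hQt : volume (cube a (8 * r)) ≠ ∞ := by
    rw [volume_cube]; finiteness
  set I := ∫⁻ y in cube a (8 * r), ∫⁻ s in Ioo 0 (8 * r), m (y, s)
  calc ∫⁻ y in ball z (3 * r), ∫⁻ s in Ioo 0 (8 * r), m (y, s)
      ≤ I := lintegral_mono_set hsub
    _ = volume (cube a (8 * r)) * ((volume (cube a (8 * r)))⁻¹ * I) := by
        rw [← mul_assoc, ENNReal.mul_inv_cancel hQ0 hQt, one_mul]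
    _ = embedConst n * (((volume (cube a (8 * r)))⁻¹ * I) * volume (ball z r)) := by
        rw [hvol]; ring
    _ ≤ _ := by
        gcongr
        rw [← setLIntegral_const]
        refine setLIntegral_mono' measurableSet_ball fun x hx => ?_
        have hx' : x ∈ cube a (8 * r) := hsub (ball_subset_ball (by linarith) hx)
        exact le_iSup_of_le a <| le_iSup_of_le (8 * r) <| le_iSup_of_le h8 <|
          le_iSup_of_le hx' le_rfl

/-- The level set form of the Carleson embedding: `{g > c}` is covered by boxes over a Vitali
subfamily of the balls `B(y, s)` with `g (y, s) > c`, all of which lie in `{N g > c}`. -/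
lemma measure_levelSet_le (hn : 1 ≤ n) {g m : Space n → ℝ≥0∞} (hm : Measurable m) {c : ℝ≥0∞}
    (hfin : volume {x | c < ntMax g x} ≠ ∞) :
    ∫⁻ P in {P | c < g P} ∩ upperHalfSpace n, m P
      ≤ embedConst n * ∫⁻ x in {x | c < ntMax g x}, carlesonMax m x := by
  set t : Set (EuclideanSpace ℝ (Fin n) × ℝ) := {P | c < g P} ∩ upperHalfSpace n
  have hball : ∀ a ∈ t, ball a.1 a.2 ⊆ {x | c < ntMax g x} := fun a ha x hx =>
    lt_ntMax_iff.2 ⟨a.1, a.2, ha.2, hx, ha.1⟩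
  obtain ⟨R, hR⟩ := exists_radius_bound hn hfin
  obtain ⟨u, hut, hu, hdisj, hcov⟩ := exists_countable_disjoint_balls t (fun a ha => ha.2) R
    (fun a ha => hR a.1 a.2 ha.2 (measure_mono (hball a ha)))
  have hcov' : t ⊆ ⋃ b ∈ u, ball b.1 (3 * b.2) ×ˢ Ioo 0 (8 * b.2) := by
    intro a ha
    obtain ⟨b, hb, h1, h2⟩ := hcov a ha
    have hb0 : 0 < b.2 := (hut hb).2
    exact mem_biUnion hb ⟨h1, ha.2, by linarith⟩
  have := hu.to_subtype
  calc ∫⁻ P in t, m P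
      ≤ ∫⁻ P in ⋃ b ∈ u, ball b.1 (3 * b.2) ×ˢ Ioo 0 (8 * b.2), m P := lintegral_mono_set hcov'
    _ ≤ ∑' b : u, ∫⁻ P in ball b.1.1 (3 * b.1.2) ×ˢ Ioo 0 (8 * b.1.2), m P := by
        rw [biUnion_eq_iUnion]
        exact lintegral_iUnion_le _ _
    _ ≤ ∑' b : u, embedConst n * ∫⁻ x in ball b.1.1 b.1.2, carlesonMax m x := by
        refine ENNReal.tsum_le_tsum fun b => ?_
        rw [Measure.volume_eq_prod, ← Measure.prod_restrict, lintegral_prod _ hm.aemeasurable]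
        exact lintegral_box_le _ (hut b.2).2
    _ = embedConst n * ∫⁻ x in ⋃ b ∈ u, ball b.1 b.2, carlesonMax m x := by
        rw [ENNReal.tsum_mul_left, lintegral_biUnion hu (fun _ _ => measurableSet_ball) hdisj]
    _ ≤ _ := by
        gcongr
        exact iUnion₂_subset fun b hb => hball b (hut hb)

/-- The Carleson embedding `∫ g dμ ≲ ∫ N(g) C(μ)`. -/
lemma lintegral_mul_le_ntMax_mul_carlesonMax (hn : 1 ≤ n) {g m : Space n → ℝ≥0∞}
    (hg : Measurable g) (hm : Measurable m)
    (hfin : ∀ c : ℝ≥0∞, 0 < c → volume {x | c < ntMax g x} ≠ ∞) (hae : ∀ᵐ x, ntMax g x ≠ ∞) :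
    ∫⁻ P in upperHalfSpace n, m P * g P
      ≤ embedConst n * ∫⁻ x, carlesonMax m x * ntMax g x := by
  -- An infinite value of `g` would make `N g` infinite on a ball.
  have hgfin : ∀ P ∈ upperHalfSpace n, g P ≠ ∞ := by
    intro P hP htop
    have h1 : ball P.1 P.2 ⊆ {x | ¬ ntMax g x ≠ ∞} := fun x hx => by
      simp only [ne_eq, not_not, mem_ofPred_eq]
      exact top_le_iff.1 (htop ▸ le_ntMax g hP hx)
    have h2 := measure_mono_null h1 (ae_iff.1 hae)
    exact (measure_ball_pos volume P.1 (show 0 < P.2 from hP)).ne' h2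
  set μ := (volume.restrict (upperHalfSpace n)).withDensity m
  set ν := (volume : Measure (EuclideanSpace ℝ (Fin n))).withDensity (carlesonMax m)
  have hN : Measurable (ntMax g) := (lowerSemicontinuous_ntMax g).measurable
  have hC : Measurable (carlesonMax m) := (lowerSemicontinuous_carlesonMax m).measurable
  have e1 : ∫⁻ P in upperHalfSpace n, m P * g P = ∫⁻ P, g P ∂μ :=
    (lintegral_withDensity_eq_lintegral_mul _ hm hg).symm
  have e2 : ∫⁻ x, carlesonMax m x * ntMax g x = ∫⁻ x, ntMax g x ∂ν :=
    (lintegral_withDensity_eq_lintegral_mul _ hC hN).symm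
  rw [e1, e2, lintegral_eq_layercake hg.aemeasurable, lintegral_eq_layercake hN.aemeasurable,
    ← lintegral_const_mul' _ _ embedConst_ne_top]
  · refine setLIntegral_mono' measurableSet_Ioi fun t ht => ?_
    rw [withDensity_apply _ (measurableSet_lt measurable_const hg),
      withDensity_apply _ (measurableSet_lt measurable_const hN),
      Measure.restrict_restrict (measurableSet_lt measurable_const hg)]
    exact measure_levelSet_le hn hm (hfin _ (ENNReal.ofReal_pos.2 ht))
  · exact (withDensity_absolutelyContinuous _ _).ae_le hae
  · exact (withDensity_absolutelyContinuous _ _).ae_le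
      ((ae_restrict_iff' measurableSet_upperHalfSpace).2 (Filter.Eventually.of_forall hgfin))

/-! ### The upper bound for the pairing -/

lemma eLpNorm_ofReal_eq_lintegral {α : Type*} [MeasurableSpace α] {μ : Measure α} (f : α → ℝ≥0∞)
    {p : ℝ} (hp : 0 < p) :
    eLpNorm f (ENNReal.ofReal p) μ = (∫⁻ x, f x ^ p ∂μ) ^ (1 / p) := by
  rw [eLpNorm_eq_lintegral_rpow_enorm_toReal (ENNReal.ofReal_pos.2 hp).ne' ENNReal.ofReal_ne_top,
    ENNReal.toReal_ofReal hp.le]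
  simp

lemma modNT_eq_ntMax {ι : Type} [Fintype ι] (u : Space n → EuclideanSpace ℂ ι) :
    modNT u = ntMax fun P => quadAverage (fun Z => ‖u Z‖ₑ) P.1 P.2 := rfl

lemma avgCarleson_eq_carlesonMax {ι : Type} [Fintype ι] (H : Space n → EuclideanSpace ℂ ι) :
    avgCarleson H = carlesonMax fun P =>
      quadAverage (fun Z => ‖H Z‖ₑ) P.1 P.2 / ENNReal.ofReal P.2 := rfl

lemma enorm_tMul {ι : Type} [Fintype ι] (H : Space n → EuclideanSpace ℂ ι) {Z : Space n}
    (hZ : Z ∈ upperHalfSpace n) : ‖tMul H Z‖ₑ = ENNReal.ofReal Z.2 * ‖H Z‖ₑ := by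
  have : ‖(Z.2 : ℂ)‖ₑ = ENNReal.ofReal Z.2 := by
    rw [← ofReal_norm, Complex.norm_real, Real.norm_of_nonneg (le_of_lt hZ)]
  rw [tMul, enorm_smul, this]

/-- On `B((y,s),s/2)` the height exceeds `s/2`; hence averages of `f h` are controlled by the
quadratic averages of `f` and of `t h`. -/
lemma laverage_mul_le {f h : Space n → ℝ≥0∞} (hf : Measurable f) (hh : Measurable h)
    (y : EuclideanSpace ℝ (Fin n)) {s : ℝ} (hs : 0 < s) :
    ⨍⁻ Z in euclBall y s (s / 2), f Z * h Z ∂volume ≤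
      2 * (quadAverage (fun Z => ENNReal.ofReal Z.2 * h Z) y s / ENNReal.ofReal s
        * quadAverage f y s) := by
  have hT : Measurable fun Z : Space n => ENNReal.ofReal Z.2 * h Z :=
    (ENNReal.measurable_ofReal.comp measurable_snd).mul hh
  have hs' : ENNReal.ofReal s ≠ 0 := (ENNReal.ofReal_pos.2 hs).ne'
  have h1 : ∀ Z ∈ euclBall y s (s / 2), f Z * h Z ≤
      2 / ENNReal.ofReal s * (f Z * (ENNReal.ofReal Z.2 * h Z)) := by
    intro Z hZ
    have h2 : 1 ≤ 2 / ENNReal.ofReal s * ENNReal.ofReal Z.2 := by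
      rw [← ENNReal.ofReal_ofNat 2, ← ENNReal.ofReal_div_of_pos hs,
        ← ENNReal.ofReal_mul (by positivity), ENNReal.one_le_ofReal]
      have := half_lt_snd_of_mem_euclBall hZ
      rw [div_mul_eq_mul_div, le_div_iff₀ hs]
      linarith
    calc f Z * h Z ≤ (2 / ENNReal.ofReal s * ENNReal.ofReal Z.2) * (f Z * h Z) :=
          le_mul_of_one_le_left' h2
      _ = _ := by ring
  calc ⨍⁻ Z in euclBall y s (s / 2), f Z * h Z ∂volume
      ≤ ⨍⁻ Z in euclBall y s (s / 2),
          2 / ENNReal.ofReal s * (f Z * (ENNReal.ofReal Z.2 * h Z)) ∂volume := by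
        rw [setLAverage_eq, setLAverage_eq]
        gcongr ?_ / _
        exact setLIntegral_mono' (measurableSet_euclBall _ _ _) h1
    _ = 2 / ENNReal.ofReal s *
          ⨍⁻ Z in euclBall y s (s / 2), f Z * (ENNReal.ofReal Z.2 * h Z) ∂volume :=
        lintegral_const_mul _ (hf.mul hT)
    _ ≤ 2 / ENNReal.ofReal s * (quadAverage f y s *
          quadAverage (fun Z => ENNReal.ofReal Z.2 * h Z) y s) := by
        gcongr
        exact laverage_mul_le_quadAverage_mul hf hT y s
    _ = _ := by
        simp only [div_eq_mul_inv]; ring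

/-- The constant in the upper bound for the pairing. -/
def pairingConst (n : ℕ) : ℝ≥0∞ := ENNReal.ofReal ((5 / 2) ^ (n + 1)) * 2 * embedConst n

lemma pairingConst_ne_top : pairingConst n ≠ ∞ :=
  ENNReal.mul_ne_top (by finiteness) embedConst_ne_top

/-- The upper bound for the pairing of measurable scalar functions: averaging, the Carleson
embedding and Hölder's inequality. Finiteness of the norm of the maximal function makes its level
sets have finite measure, as the Vitali covering requires. -/
lemma lintegral_mul_le_of_measurable (hn : 1 ≤ n) {p q : ℝ} (hpq : p.HolderConjugate q)
    {f h : Space n → ℝ≥0∞} (hf : Measurable f) (hh : Measurable h)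
    (hN : eLpNorm (ntMax fun P => quadAverage f P.1 P.2) (ENNReal.ofReal p) volume ≠ ∞) :
    ∫⁻ Z in upperHalfSpace n, f Z * h Z ≤ pairingConst n *
      eLpNorm (ntMax fun P => quadAverage f P.1 P.2) (ENNReal.ofReal p) volume *
      eLpNorm (carlesonMax fun P =>
        quadAverage (fun Z => ENNReal.ofReal Z.2 * h Z) P.1 P.2 / ENNReal.ofReal P.2)
        (ENNReal.ofReal q) volume := by
  set g : Space n → ℝ≥0∞ := fun P => quadAverage f P.1 P.2
  set m : Space n → ℝ≥0∞ := fun P =>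
    quadAverage (fun Z => ENNReal.ofReal Z.2 * h Z) P.1 P.2 / ENNReal.ofReal P.2
  have hg : Measurable g := measurable_quadAverage hf
  have hm : Measurable m :=
    (measurable_quadAverage ((ENNReal.measurable_ofReal.comp measurable_snd).mul hh)).div
      (ENNReal.measurable_ofReal.comp measurable_snd)
  have hNm : Measurable (ntMax g) := (lowerSemicontinuous_ntMax g).measurable
  have hCm : Measurable (carlesonMax m) := (lowerSemicontinuous_carlesonMax m).measurable
  have hp := hpq.pos
  have hq := hpq.symm.pos
  rw [eLpNorm_ofReal_eq_lintegral _ hp] at hN ⊢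
  rw [eLpNorm_ofReal_eq_lintegral _ hq]
  have hNp : ∫⁻ x, ntMax g x ^ p ≠ ∞ := fun h => hN (by simp [h, hp])
  have hfin : ∀ c : ℝ≥0∞, 0 < c → volume {x | c < ntMax g x} ≠ ∞ := by
    intro c hc
    rcases eq_or_ne c ∞ with rfl | hct
    · simp
    have h1 := mul_meas_ge_le_lintegral (μ := volume) (hNm.pow_const p) (c ^ p)
    have h2 : volume {x | c ^ p ≤ ntMax g x ^ p} ≠ ∞ := by
      intro h
      rw [h, ENNReal.mul_top (ENNReal.rpow_pos hc hct).ne'] at h1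
      exact hNp (top_le_iff.1 h1)
    refine ne_top_of_le_ne_top h2 (measure_mono fun x hx => ?_)
    exact ENNReal.rpow_le_rpow (le_of_lt hx) hp.le
  have hae : ∀ᵐ x, ntMax g x ≠ ∞ := by
    filter_upwards [ae_lt_top (hNm.pow_const p) hNp] with x hx h
    rw [h, ENNReal.top_rpow_of_pos hp] at hx
    exact lt_irrefl _ hx
  calc ∫⁻ Z in upperHalfSpace n, f Z * h Z
      ≤ ENNReal.ofReal ((5 / 2) ^ (n + 1)) * ∫⁻ P in upperHalfSpace n,
          ⨍⁻ Z in euclBall P.1 P.2 (P.2 / 2), f Z * h Z ∂volume :=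
        lintegral_upperHalfSpace_le (hf.mul hh)
    _ ≤ ENNReal.ofReal ((5 / 2) ^ (n + 1)) * ∫⁻ P in upperHalfSpace n, 2 * (m P * g P) := by
        gcongr _ * ?_
        exact setLIntegral_mono' measurableSet_upperHalfSpace fun P hP =>
          laverage_mul_le hf hh P.1 hP
    _ = ENNReal.ofReal ((5 / 2) ^ (n + 1)) * 2 * ∫⁻ P in upperHalfSpace n, m P * g P := by
        rw [lintegral_const_mul _ (show Measurable fun P => m P * g P from hm.mul hg), mul_assoc]
    _ ≤ ENNReal.ofReal ((5 / 2) ^ (n + 1)) * 2 *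
          (embedConst n * ∫⁻ x, carlesonMax m x * ntMax g x) := by
        gcongr
        exact lintegral_mul_le_ntMax_mul_carlesonMax hn hg hm hfin hae
    _ ≤ ENNReal.ofReal ((5 / 2) ^ (n + 1)) * 2 * (embedConst n *
          ((∫⁻ x, carlesonMax m x ^ q) ^ (1 / q) * (∫⁻ x, ntMax g x ^ p) ^ (1 / p))) := by
        gcongr
        exact ENNReal.lintegral_mul_le_Lp_mul_Lq volume hpq.symm hCm.aemeasurable hNm.aemeasurable
    _ = _ := by rw [pairingConst]; ring

lemma lintegral_enorm_mul_enorm_le (hn : 1 ≤ n) {p q : ℝ} (hpq : p.HolderConjugate q)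
    {ι : Type} [Fintype ι] {u H : Space n → EuclideanSpace ℂ ι}
    (hu : AEStronglyMeasurable u (volume.restrict (upperHalfSpace n)))
    (hH : AEStronglyMeasurable H (volume.restrict (upperHalfSpace n)))
    (hN : eLpNorm (modNT u) (ENNReal.ofReal p) volume ≠ ∞) :
    ∫⁻ Z in upperHalfSpace n, ‖u Z‖ₑ * ‖H Z‖ₑ ≤ pairingConst n *
      eLpNorm (modNT u) (ENNReal.ofReal p) volume *
      eLpNorm (avgCarleson (tMul H)) (ENNReal.ofReal q) volume := by
  obtain ⟨f, hf, huf⟩ := hu.enorm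
  obtain ⟨h, hh, hHh⟩ := hH.enorm
  have e1 : modNT u = ntMax fun P => quadAverage f P.1 P.2 := by
    rw [modNT_eq_ntMax]
    congr 1; ext P
    exact quadAverage_congr_ae huf _ _
  have e2 : avgCarleson (tMul H) = carlesonMax fun P =>
      quadAverage (fun Z => ENNReal.ofReal Z.2 * h Z) P.1 P.2 / ENNReal.ofReal P.2 := by
    rw [avgCarleson_eq_carlesonMax]
    congr 1; ext P
    congr 1
    refine quadAverage_congr_ae ?_ _ _
    filter_upwards [hHh, ae_restrict_mem measurableSet_upperHalfSpace] with Z h1 h2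
    rw [enorm_tMul H h2, h1]
  have e3 : ∫⁻ Z in upperHalfSpace n, ‖u Z‖ₑ * ‖H Z‖ₑ =
      ∫⁻ Z in upperHalfSpace n, f Z * h Z := by
    refine lintegral_congr_ae ?_
    filter_upwards [huf, hHh] with Z h1 h2
    rw [h1, h2]
  rw [e1] at hN ⊢
  rw [e2, e3]
  exact lintegral_mul_le_of_measurable hn hpq hf hh hN

/-- If `|u| |H|` is integrable, then the integrals in `⟨u, H⟩` converge absolutely. -/
lemma integrableOn_conj_mul {ι : Type} [Fintype ι] {u H : Space n → EuclideanSpace ℂ ι}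
    (hu : AEStronglyMeasurable u (volume.restrict (upperHalfSpace n)))
    (hH : AEStronglyMeasurable H (volume.restrict (upperHalfSpace n)))
    (hlt : ∫⁻ Z in upperHalfSpace n, ‖u Z‖ₑ * ‖H Z‖ₑ < ∞) (j : ι) :
    IntegrableOn (fun X => starRingEnd ℂ (u X j) * H X j) (upperHalfSpace n) volume := by
  have hcoord : ∀ v : Space n → EuclideanSpace ℂ ι,
      AEStronglyMeasurable v (volume.restrict (upperHalfSpace n)) →
      AEStronglyMeasurable (fun X => v X j) (volume.restrict (upperHalfSpace n)) := fun v hv =>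
    (PiLp.continuous_apply 2 (fun _ : ι => ℂ) j).comp_aestronglyMeasurable hv
  refine ⟨(Complex.continuous_conj.comp_aestronglyMeasurable (hcoord u hu)).mul (hcoord H hH), ?_⟩
  refine lt_of_le_of_lt (lintegral_mono fun X => ?_) hlt
  rw [enorm_mul]
  refine mul_le_mul' ?_ ?_
  · rw [← ofReal_norm, RCLike.norm_conj, ← ofReal_norm]
    exact ENNReal.ofReal_le_ofReal (PiLp.norm_apply_le (u X) j)
  · rw [← ofReal_norm, ← ofReal_norm]
    exact ENNReal.ofReal_le_ofReal (PiLp.norm_apply_le (H X) j)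

lemma pairing_eq_integral_inner {ι : Type} [Fintype ι] {u H : Space n → EuclideanSpace ℂ ι}
    (hint : ∀ j, IntegrableOn (fun X => starRingEnd ℂ (u X j) * H X j) (upperHalfSpace n) volume) :
    pairing u H = ∫ X in upperHalfSpace n, inner ℂ (u X) (H X) := by
  rw [pairing, ← integral_finsetSum _ fun j _ => hint j]
  congr 1; ext X
  simp [PiLp.inner_apply, mul_comm]

lemma enorm_pairing_le {ι : Type} [Fintype ι] {u H : Space n → EuclideanSpace ℂ ι}
    (hint : ∀ j, IntegrableOn (fun X => starRingEnd ℂ (u X j) * H X j) (upperHalfSpace n) volume) :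
    ‖pairing u H‖ₑ ≤ ∫⁻ Z in upperHalfSpace n, ‖u Z‖ₑ * ‖H Z‖ₑ := by
  rw [pairing_eq_integral_inner hint]
  refine (enorm_integral_le_lintegral_enorm _).trans (lintegral_mono fun X => ?_)
  rw [← ofReal_norm, ← ofReal_norm, ← ofReal_norm, ← ENNReal.ofReal_mul (norm_nonneg _)]
  exact ENNReal.ofReal_le_ofReal (norm_inner_le_norm _ _)

/-! ### The Hardy–Littlewood maximal inequality -/

/-- The uncentred Hardy–Littlewood maximal function over balls of `ℝⁿ`. -/
def hlMax (h : EuclideanSpace ℝ (Fin n) → ℝ≥0∞) (x : EuclideanSpace ℝ (Fin n)) : ℝ≥0∞ :=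
  ⨆ (z : EuclideanSpace ℝ (Fin n)) (r : ℝ) (_ : 0 < r) (_ : dist x z < r),
    (volume (ball z r))⁻¹ * ∫⁻ y in ball z r, h y

lemma le_hlMax (h : EuclideanSpace ℝ (Fin n) → ℝ≥0∞) {x z : EuclideanSpace ℝ (Fin n)} {r : ℝ}
    (hr : 0 < r) (hx : dist x z < r) :
    (volume (ball z r))⁻¹ * ∫⁻ y in ball z r, h y ≤ hlMax h x :=
  le_iSup_of_le z <| le_iSup_of_le r <| le_iSup_of_le hr <| le_iSup_of_le hx le_rfl

/-- `hlMax h` is the nontangential maximal function of the averages of `h` over balls. -/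
lemma hlMax_eq_ntMax (h : EuclideanSpace ℝ (Fin n) → ℝ≥0∞) :
    hlMax h = ntMax fun P => (volume (ball P.1 P.2))⁻¹ * ∫⁻ y in ball P.1 P.2, h y := rfl

lemma measurable_hlMax (h : EuclideanSpace ℝ (Fin n) → ℝ≥0∞) : Measurable (hlMax h) :=
  hlMax_eq_ntMax h ▸ (lowerSemicontinuous_ntMax _).measurable

/-- The weak type estimate, localised to the set where `h` exceeds half the level. -/
lemma measure_hlMax_gt_le (hn : 1 ≤ n) {h : EuclideanSpace ℝ (Fin n) → ℝ≥0∞} (hh : Measurable h)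
    (hint : ∫⁻ y, h y ≠ ∞) {c : ℝ≥0∞} (hc : c ≠ 0) (hct : c ≠ ∞) :
    c * volume {x | c < hlMax h x} ≤
      2 * 5 ^ n * ∫⁻ y in {y | c < 2 * h y}, h y := by
  set A : Set (EuclideanSpace ℝ (Fin n)) := {y | c < 2 * h y}
  have hA : MeasurableSet A := measurableSet_lt measurable_const (hh.const_mul 2)
  set t : Set (EuclideanSpace ℝ (Fin n) × ℝ) :=
    {a | 0 < a.2 ∧ c < (volume (ball a.1 a.2))⁻¹ * ∫⁻ y in ball a.1 a.2, h y}
  have hlow : ∀ a ∈ t, c * volume (ball a.1 a.2) ≤ ∫⁻ y in ball a.1 a.2, h y := by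
    intro a ha
    have h1 := ha.2.le
    rw [mul_comm, ← div_eq_mul_inv, ENNReal.le_div_iff_mul_le
      (Or.inl (measure_ball_pos volume _ ha.1).ne') (Or.inl measure_ball_lt_top.ne)] at h1
    exact h1
  obtain ⟨R, hR⟩ := exists_radius_bound hn (ENNReal.div_ne_top hint hc)
  obtain ⟨w, hwt, hw, hdisj, hcov⟩ := exists_countable_disjoint_balls t (fun a ha => ha.1) R
    (fun a ha => hR a.1 a.2 ha.1 (by
      rw [ENNReal.le_div_iff_mul_le (Or.inl hc) (Or.inl hct), mul_comm]
      exact (hlow a ha).trans (setLIntegral_le_lintegral _ _)))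
  -- Off `A` the function `h` is at most `c / 2`, which accounts for at most half of the integral.
  have hball : ∀ a ∈ t, c * volume (ball a.1 a.2) ≤ 2 * ∫⁻ y in ball a.1 a.2 ∩ A, h y := by
    intro a ha
    have hVt : c * volume (ball a.1 a.2) ≠ ∞ := ENNReal.mul_ne_top hct measure_ball_lt_top.ne
    refine (ENNReal.add_le_add_iff_right hVt).1 ?_
    calc c * volume (ball a.1 a.2) + c * volume (ball a.1 a.2)
        = 2 * (c * volume (ball a.1 a.2)) := (two_mul _).symm
      _ ≤ 2 * ∫⁻ y in ball a.1 a.2, h y := by gcongr; exact hlow a ha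
      _ = 2 * ((∫⁻ y in ball a.1 a.2 ∩ A, h y) + ∫⁻ y in ball a.1 a.2 \ A, h y) := by
          rw [lintegral_inter_add_sdiff _ _ hA]
      _ = 2 * (∫⁻ y in ball a.1 a.2 ∩ A, h y) + ∫⁻ y in ball a.1 a.2 \ A, 2 * h y := by
          rw [mul_add, lintegral_const_mul _ hh]
      _ ≤ 2 * (∫⁻ y in ball a.1 a.2 ∩ A, h y) + ∫⁻ _y in ball a.1 a.2 \ A, c := by
          gcongr _ + ?_
          exact setLIntegral_mono' (measurableSet_ball.diff hA) fun y hy => not_lt.1 hy.2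
      _ ≤ _ := by
          rw [setLIntegral_const]
          gcongr
          exact sdiff_subset
  have hsub : {x | c < hlMax h x} ⊆ ⋃ b ∈ w, ball b.1 (5 * b.2) := by
    intro x hx
    rw [mem_ofPred_eq, hlMax_eq_ntMax, lt_ntMax_iff] at hx
    obtain ⟨z, r, hr, hxz, hzr⟩ := hx
    obtain ⟨b, hb, h1, h2⟩ := hcov (z, r) ⟨hr, hzr⟩
    refine mem_biUnion hb ?_
    rw [mem_ball]
    have := dist_triangle x z b.1
    simp only at h1 h2
    linarith
  have := hw.to_subtype
  have h5 : ENNReal.ofReal (5 ^ n) = 5 ^ n := by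
    rw [ENNReal.ofReal_pow (by norm_num)]; norm_num
  calc c * volume {x | c < hlMax h x}
      ≤ c * ∑' b : w, volume (ball b.1.1 (5 * b.1.2)) := by
        gcongr
        refine (measure_mono hsub).trans ?_
        rw [biUnion_eq_iUnion]
        exact measure_iUnion_le _
    _ = ∑' b : w, 5 ^ n * (c * volume (ball b.1.1 b.1.2)) := by
        rw [← ENNReal.tsum_mul_left]
        refine tsum_congr fun b => ?_
        have hb : 0 < b.1.2 := (hwt b.2).1
        rw [volume_ball_eq _ hb, volume_ball_eq _ (by positivity : 0 < 5 * b.1.2), mul_pow,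
          ENNReal.ofReal_mul (by positivity), h5]
        ring
    _ ≤ ∑' b : w, 5 ^ n * (2 * ∫⁻ y in ball b.1.1 b.1.2 ∩ A, h y) := by
        refine ENNReal.tsum_le_tsum fun b => ?_
        gcongr _ * ?_
        exact hball _ (hwt b.2)
    _ = 2 * 5 ^ n * ∫⁻ y in ⋃ b ∈ w, ball b.1 b.2 ∩ A, h y := by
        rw [lintegral_biUnion hw (fun _ _ => measurableSet_ball.inter hA)
          (hdisj.mono fun _ => inter_subset_left), ← ENNReal.tsum_mul_left]
        refine tsum_congr fun b => ?_
        ring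
    _ ≤ _ := by
        gcongr
        exact iUnion₂_subset fun b _ => inter_subset_right

/-- Finiteness almost everywhere, from the weak type estimate at large levels. -/
lemma ae_hlMax_ne_top (hn : 1 ≤ n) {h : EuclideanSpace ℝ (Fin n) → ℝ≥0∞} (hh : Measurable h)
    (hint : ∫⁻ y, h y ≠ ∞) : ∀ᵐ x, hlMax h x ≠ ∞ := by
  rw [ae_iff]
  by_contra h0
  obtain ⟨k, hk⟩ := ENNReal.exists_nat_mul_gt h0
    (ENNReal.mul_ne_top (by finiteness : (2 * 5 ^ n : ℝ≥0∞) ≠ ∞) hint)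
  have hk0 : (k : ℝ≥0∞) ≠ 0 := by
    rintro h
    simp [h] at hk
  refine absurd hk (not_lt.2 ?_)
  calc (k : ℝ≥0∞) * volume {x | ¬ hlMax h x ≠ ∞} ≤ k * volume {x | (k : ℝ≥0∞) < hlMax h x} := by
        refine mul_le_mul_right (measure_mono fun x hx => ?_) _
        simp only [ne_eq, not_not, mem_ofPred_eq] at hx ⊢
        rw [hx]
        exact ENNReal.natCast_lt_top k
    _ ≤ 2 * 5 ^ n * ∫⁻ y in {y | (k : ℝ≥0∞) < 2 * h y}, h y :=
        measure_hlMax_gt_le hn hh hint hk0 (ENNReal.natCast_ne_top k)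
    _ ≤ _ := by
        gcongr _ * ?_
        exact setLIntegral_le_lintegral _ _

/-- The constant in the maximal inequality on `L^q`. -/
def hlConst (n : ℕ) (q : ℝ) : ℝ≥0∞ :=
  ENNReal.ofReal q * (2 * 5 ^ n) * ((ENNReal.ofReal (q - 1))⁻¹ * 2 ^ (q - 1))

lemma hlConst_ne_top {q : ℝ} (hq : 1 < q) : hlConst n q ≠ ∞ := by
  refine ENNReal.mul_ne_top (by finiteness) (ENNReal.mul_ne_top ?_ ?_)
  · exact ENNReal.inv_ne_top.2 (ENNReal.ofReal_pos.2 (by linarith)).ne'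
  · exact ENNReal.rpow_ne_top_of_nonneg (by linarith) (by norm_num)

/-- The Hardy–Littlewood maximal inequality, by integration of the weak type estimate. -/
lemma lintegral_hlMax_rpow_le (hn : 1 ≤ n) {q : ℝ} (hq : 1 < q)
    {h : EuclideanSpace ℝ (Fin n) → ℝ≥0∞} (hh : Measurable h) (hfin : ∀ y, h y ≠ ∞)
    (hint : ∫⁻ y, h y ≠ ∞) :
    ∫⁻ x, hlMax h x ^ q ≤ hlConst n q * ∫⁻ y, h y ^ q := by
  have hq1 : 0 < q - 1 := by linarith
  have hq1' : ENNReal.ofReal (q - 1) ≠ 0 := (ENNReal.ofReal_pos.2 hq1).ne'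
  set ν := (volume : Measure (EuclideanSpace ℝ (Fin n))).withDensity h
  have hlc := lintegral_rpow_eq_layercake (μ := ν) (f := fun y => 2 * h y)
    (hh.const_mul 2).aemeasurable
    (Filter.Eventually.of_forall fun y => ENNReal.mul_ne_top (by norm_num) (hfin y)) hq1
  set I := ∫⁻ t in Ioi (0 : ℝ), ν {y | ENNReal.ofReal t < 2 * h y} *
    ENNReal.ofReal (t ^ (q - 1 - 1))
  -- The localised weak estimate integrates to a layer cake formula for `2 h` against `h dx`.
  have hI : I = (ENNReal.ofReal (q - 1))⁻¹ * ∫⁻ y, (2 * h y) ^ (q - 1) ∂ν := by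
    rw [hlc, ← mul_assoc, ENNReal.inv_mul_cancel hq1' ENNReal.ofReal_ne_top, one_mul]
  have hν : ∫⁻ y, (2 * h y) ^ (q - 1) ∂ν = 2 ^ (q - 1) * ∫⁻ y, h y ^ q := by
    rw [lintegral_withDensity_eq_lintegral_mul _ hh ((hh.const_mul 2).pow_const _),
      ← lintegral_const_mul _ (hh.pow_const q)]
    refine lintegral_congr fun y => ?_
    have e : h y ^ q = h y ^ (q - 1) * h y := by
      conv_lhs => rw [show q = (q - 1) + 1 by ring,
        ENNReal.rpow_add_of_nonneg _ _ hq1.le zero_le_one, ENNReal.rpow_one]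
    rw [Pi.mul_apply, ENNReal.mul_rpow_of_nonneg _ _ hq1.le, e]
    ring
  rw [lintegral_rpow_eq_layercake (measurable_hlMax h).aemeasurable (ae_hlMax_ne_top hn hh hint)
    (by linarith : 0 < q)]
  calc ENNReal.ofReal q * ∫⁻ t in Ioi (0 : ℝ),
        volume {x | ENNReal.ofReal t < hlMax h x} * ENNReal.ofReal (t ^ (q - 1))
      ≤ ENNReal.ofReal q * ∫⁻ t in Ioi (0 : ℝ), 2 * 5 ^ n *
          (ν {y | ENNReal.ofReal t < 2 * h y} * ENNReal.ofReal (t ^ (q - 1 - 1))) := by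
        gcongr _ * ?_
        refine setLIntegral_mono' measurableSet_Ioi fun t ht => ?_
        have ht0 : 0 < t := ht
        have e : ENNReal.ofReal (t ^ (q - 1)) =
            ENNReal.ofReal t * ENNReal.ofReal (t ^ (q - 1 - 1)) := by
          rw [← ENNReal.ofReal_mul ht0.le, Real.rpow_sub_one ht0.ne' (q - 1),
            mul_div_cancel₀ _ ht0.ne']
        rw [e, ← mul_assoc, ← mul_assoc, mul_comm (volume _),
          withDensity_apply _ (measurableSet_lt measurable_const (hh.const_mul 2))]
        gcongr ?_ * _
        exact measure_hlMax_gt_le hn hh hint (ENNReal.ofReal_pos.2 ht0).ne' ENNReal.ofReal_ne_top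
    _ = hlConst n q * ∫⁻ y, h y ^ q := by
        rw [lintegral_const_mul' _ _ (by finiteness), show (∫⁻ t in Ioi (0 : ℝ),
          ν {y | ENNReal.ofReal t < 2 * h y} * ENNReal.ofReal (t ^ (q - 1 - 1))) = I from rfl,
          hI, hν, hlConst]
        ring

/-! ### The Carleson function of an array supported in one Whitney ball -/

lemma quadAverage_mono {f g : Space n → ℝ≥0∞} {y : EuclideanSpace ℝ (Fin n)} {s : ℝ}
    (h : ∀ Z ∈ euclBall y s (s / 2), f Z ≤ g Z) : quadAverage f y s ≤ quadAverage g y s := by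
  simp only [quadAverage, setLAverage_eq]
  gcongr ?_ ^ _
  gcongr ?_ / _
  exact setLIntegral_mono' (measurableSet_euclBall _ _ _) fun Z hZ => by gcongr; exact h Z hZ

/-- The Whitney ball `B((y,s),s/2)` attached to the point `P = (y,s)`. -/
def whitneyBall (P : Space n) : Set (Space n) := euclBall P.1 P.2 (P.2 / 2)

/-- The function `t f`, cut off to the Whitney ball of `P`. -/
def whitneyPiece (f : Space n → ℝ≥0∞) (P : Space n) : Space n → ℝ≥0∞ :=
  (whitneyBall P).indicator fun Z => ENNReal.ofReal Z.2 * f Z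

lemma measurable_whitneyPiece {f : Space n → ℝ≥0∞} (hf : Measurable f) (P : Space n) :
    Measurable (whitneyPiece f P) :=
  ((ENNReal.measurable_ofReal.comp measurable_snd).mul hf).indicator (measurableSet_euclBall _ _ _)

/-- If two Whitney balls meet, then their centres and radii are comparable. -/
lemma comparable_of_mem_whitneyBall {P : Space n} {y : EuclideanSpace ℝ (Fin n)} {s : ℝ}
    {Z : Space n} (h1 : Z ∈ euclBall y s (s / 2)) (h2 : Z ∈ whitneyBall P) :
    dist y P.1 < 2 * P.2 ∧ s < 3 * P.2 ∧ P.2 < 3 * s := by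
  have a1 := half_lt_snd_of_mem_euclBall h1
  have a2 := snd_lt_of_mem_euclBall h1
  have b1 := half_lt_snd_of_mem_euclBall h2
  have b2 := snd_lt_of_mem_euclBall h2
  have d1 := dist_fst_lt_of_mem_euclBall h1
  have d2 := dist_fst_lt_of_mem_euclBall h2
  have := dist_triangle_left y P.1 Z.1
  refine ⟨?_, ?_, ?_⟩ <;> linarith

lemma setLIntegral_sq_eq_quadAverage (f : Space n → ℝ≥0∞) (y : EuclideanSpace ℝ (Fin n)) (s : ℝ) :
    ∫⁻ Z in euclBall y s (s / 2), f Z ^ 2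
      = volume (euclBall y s (s / 2) : Set (Space n)) * quadAverage f y s ^ 2 := by
  rw [quadAverage, ← ENNReal.rpow_natCast, ← ENNReal.rpow_mul]
  norm_num
  exact (measure_mul_setLAverage _ (volume_euclBall_ne_top _ _ _)).symm

/-- The averages of a Whitney piece over all other Whitney balls: they vanish away from `P`, and
near `P` all heights and volumes involved are comparable to those at `P`. -/
lemma quadAverage_whitneyPiece_le {f : Space n → ℝ≥0∞} (hf : Measurable f) {P : Space n}
    (hP : 0 < P.2) (y : EuclideanSpace ℝ (Fin n)) {s : ℝ} (hs : 0 < s) :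
    quadAverage (whitneyPiece f P) y s / ENNReal.ofReal s ≤
      (ball P.1 (2 * P.2)).indicator (fun _ => (Iio (3 * P.2)).indicator
        (fun _ => ENNReal.ofReal (9 / 2 * 3 ^ (n + 1)) * quadAverage f P.1 P.2) s) y := by
  by_cases hmeet : ∃ Z ∈ euclBall y s (s / 2), Z ∈ whitneyBall P
  swap
  · have : quadAverage (whitneyPiece f P) y s ≤ 0 := by
      rw [← quadAverage_zero y s]
      refine quadAverage_mono fun Z hZ => ?_
      rw [whitneyPiece, indicator_of_notMem fun h => hmeet ⟨Z, hZ, h⟩]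
    rw [le_zero_iff.1 this, ENNReal.zero_div]
    exact zero_le
  obtain ⟨Z, hZ1, hZ2⟩ := hmeet
  obtain ⟨h1, h2, h3⟩ := comparable_of_mem_whitneyBall hZ1 hZ2
  rw [indicator_of_mem (show y ∈ ball P.1 (2 * P.2) from h1),
    indicator_of_mem (show s ∈ Iio (3 * P.2) from h2)]
  set B : Set (Space n) := euclBall y s (s / 2)
  set B' : Set (Space n) := whitneyBall P
  have hB' : MeasurableSet B' := measurableSet_euclBall _ _ _
  have hV : volume B' ≤ ENNReal.ofReal (3 ^ (n + 1)) * volume B := by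
    rw [show B' = euclBall P.1 P.2 (P.2 / 2) from rfl, volume_euclBall _ _ (half_pos hP),
      volume_euclBall _ _ (half_pos hs), ← mul_assoc, ← ENNReal.ofReal_mul (by positivity),
      ← mul_pow]
    gcongr ENNReal.ofReal (?_ ^ _) * _
    linarith
  have hB0 : volume B ≠ 0 := volume_euclBall_ne_zero _ _ (half_pos hs)
  have hBt : volume B ≠ ∞ := volume_euclBall_ne_top _ _ _
  -- The cut-off of `f` to `B'` has its average over `B` controlled by its average over `B'`.
  have hcut : quadAverage (B'.indicator f) y s ≤
      ENNReal.ofReal (3 ^ (n + 1)) * quadAverage f P.1 P.2 := by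
    have hsq : (∫⁻ Z in B, (B'.indicator f Z) ^ 2) / volume B ≤
        (ENNReal.ofReal (3 ^ (n + 1)) * quadAverage f P.1 P.2) ^ 2 := by
      rw [ENNReal.div_le_iff hB0 hBt]
      calc ∫⁻ Z in B, (B'.indicator f Z) ^ 2 ≤ ∫⁻ Z, (B'.indicator f Z) ^ 2 :=
            setLIntegral_le_lintegral _ _
        _ = ∫⁻ Z in B', f Z ^ 2 := by
            rw [← lintegral_indicator hB']
            refine lintegral_congr fun Z => ?_
            by_cases h : Z ∈ B' <;> simp [h]
        _ = volume B' * quadAverage f P.1 P.2 ^ 2 := setLIntegral_sq_eq_quadAverage f _ _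
        _ ≤ (ENNReal.ofReal (3 ^ (n + 1)) * volume B) * quadAverage f P.1 P.2 ^ 2 := by gcongr
        _ ≤ (ENNReal.ofReal (3 ^ (n + 1)) ^ 2 * volume B) * quadAverage f P.1 P.2 ^ 2 := by
            gcongr ?_ * _ * _
            refine le_self_pow₀ ?_ two_ne_zero
            rw [ENNReal.one_le_ofReal]
            exact one_le_pow₀ (by norm_num)
        _ = _ := by ring
    have h2 : ∀ c : ℝ≥0∞, (c ^ 2) ^ (1 / 2 : ℝ) = c := fun c => by
      rw [← ENNReal.rpow_natCast, ← ENNReal.rpow_mul]; simp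
    rw [quadAverage, setLAverage_eq, ← h2 (ENNReal.ofReal (3 ^ (n + 1)) * quadAverage f P.1 P.2)]
    exact ENNReal.rpow_le_rpow hsq (by norm_num)
  have hpiece : quadAverage (whitneyPiece f P) y s ≤
      ENNReal.ofReal (3 * P.2 / 2) * quadAverage (B'.indicator f) y s := by
    rw [← quadAverage_const_mul (hf.indicator hB')]
    refine quadAverage_mono fun Z _ => ?_
    by_cases h : Z ∈ B'
    · rw [whitneyPiece, indicator_of_mem h, indicator_of_mem h]
      gcongr
      exact (snd_lt_of_mem_euclBall h).le
    · rw [whitneyPiece, indicator_of_notMem h]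
      exact zero_le
  rw [ENNReal.div_le_iff (ENNReal.ofReal_pos.2 hs).ne' ENNReal.ofReal_ne_top]
  calc quadAverage (whitneyPiece f P) y s
      ≤ ENNReal.ofReal (3 * P.2 / 2) *
          (ENNReal.ofReal (3 ^ (n + 1)) * quadAverage f P.1 P.2) := by
        refine hpiece.trans ?_
        gcongr
    _ ≤ ENNReal.ofReal (9 / 2 * s) *
          (ENNReal.ofReal (3 ^ (n + 1)) * quadAverage f P.1 P.2) := by
        gcongr ENNReal.ofReal ?_ * _
        linarith
    _ = _ := by
        rw [ENNReal.ofReal_mul (by positivity), ENNReal.ofReal_mul (by positivity)]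
        ring

/-- The constant bounding the mass of a Whitney piece. -/
def massConst (n : ℕ) : ℝ≥0∞ :=
  ENNReal.ofReal (9 / 2 * 3 ^ (n + 1)) * (ENNReal.ofReal (6 * 4 ^ n) *
    (volume (ball (0 : EuclideanSpace ℝ (Fin n)) 1) / unitBallVolume n))

lemma massConst_ne_top : massConst n ≠ ∞ := by
  refine ENNReal.mul_ne_top ENNReal.ofReal_ne_top (ENNReal.mul_ne_top ENNReal.ofReal_ne_top ?_)
  exact ENNReal.div_ne_top measure_ball_lt_top.ne unitBallVolume_ne_zero

/-- The mass in a box of one Whitney piece; it is localised near the box. -/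
lemma lintegral_whitneyPiece_le (hn : 1 ≤ n) {f : Space n → ℝ≥0∞} (hf : Measurable f)
    {P : Space n} (hP : 0 < P.2) {a x : EuclideanSpace ℝ (Fin n)} {ℓ : ℝ} (hx : x ∈ cube a ℓ)
    (hne : ∫⁻ y in cube a ℓ, ∫⁻ s in Ioo 0 ℓ,
      quadAverage (whitneyPiece f P) y s / ENNReal.ofReal s ≠ 0) :
    ball P.1 P.2 ⊆ ball x ((n + 9) * ℓ) ∧
    ∫⁻ y in cube a ℓ, ∫⁻ s in Ioo 0 ℓ, quadAverage (whitneyPiece f P) y s / ENNReal.ofReal s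
      ≤ massConst n * (volume (whitneyBall P) * quadAverage f P.1 P.2) := by
  constructor
  · have hex : ∃ y ∈ cube a ℓ, ∃ s ∈ Ioo 0 ℓ, ∃ Z ∈ euclBall y s (s / 2), Z ∈ whitneyBall P := by
      by_contra! hcon
      refine hne ?_
      rw [← nonpos_iff_eq_zero]
      calc _ ≤ ∫⁻ _y in cube a ℓ, ∫⁻ _s in Ioo 0 ℓ, (0 : ℝ≥0∞) := by
            refine setLIntegral_mono' (isOpen_cube a ℓ).measurableSet fun y hy => ?_
            refine setLIntegral_mono' measurableSet_Ioo fun s hs => ?_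
            have : quadAverage (whitneyPiece f P) y s ≤ 0 := by
              rw [← quadAverage_zero y s]
              refine quadAverage_mono fun Z hZ => ?_
              rw [whitneyPiece, indicator_of_notMem (hcon y hy s hs Z hZ)]
            rw [le_zero_iff.1 this, ENNReal.zero_div]
        _ = 0 := by simp
    obtain ⟨y, hy, s, hs, Z, hZ1, hZ2⟩ := hex
    obtain ⟨h1, h2, h3⟩ := comparable_of_mem_whitneyBall hZ1 hZ2
    have hxy := dist_lt_of_mem_cube hn hx hy
    intro z hz
    rw [mem_ball] at hz ⊢
    -- `|z - x| < P.2 + 2 * P.2 + n ℓ`, and `P.2 < 3 * s < 3 * ℓ`.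
    have t1 := dist_triangle4 z P.1 y x
    rw [dist_comm P.1 y, dist_comm y x] at t1
    have := hs.2
    linarith
  · set K := ENNReal.ofReal (9 / 2 * 3 ^ (n + 1)) * quadAverage f P.1 P.2
    calc _ ≤ ∫⁻ y in cube a ℓ, ∫⁻ s in Ioo 0 ℓ, (ball P.1 (2 * P.2)).indicator
            (fun _ => (Iio (3 * P.2)).indicator (fun _ => K) s) y := by
          refine lintegral_mono fun y => ?_
          exact setLIntegral_mono' measurableSet_Ioo fun s hs =>
            quadAverage_whitneyPiece_le hf hP y hs.1
      _ ≤ ∫⁻ y, ∫⁻ s in Ioi 0, (ball P.1 (2 * P.2)).indicator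
            (fun _ => (Iio (3 * P.2)).indicator (fun _ => K) s) y := by
          refine (setLIntegral_le_lintegral _ _).trans (lintegral_mono fun y => ?_)
          exact lintegral_mono_set Ioo_subset_Ioi_self
      _ = ∫⁻ y, (ball P.1 (2 * P.2)).indicator (fun _ => K * ENNReal.ofReal (3 * P.2)) y := by
          refine lintegral_congr fun y => ?_
          by_cases hy : y ∈ ball P.1 (2 * P.2)
          · simp only [indicator_of_mem hy]
            rw [lintegral_indicator_const measurableSet_Iio,
              Measure.restrict_apply measurableSet_Iio, Iio_inter_Ioi, Real.volume_Ioo, sub_zero]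
          · simp [indicator_of_notMem hy]
      _ = K * ENNReal.ofReal (3 * P.2) * volume (ball P.1 (2 * P.2)) :=
          lintegral_indicator_const measurableSet_ball _
      _ = _ := by
          have hκ : unitBallVolume n ≠ 0 := unitBallVolume_ne_zero
          have hκ' : unitBallVolume n ≠ ∞ := unitBallVolume_ne_top
          rw [whitneyBall, volume_euclBall _ _ (half_pos hP), volume_ball_eq _ (by positivity),
            massConst]
          set v := volume (ball (0 : EuclideanSpace ℝ (Fin n)) 1)
          calc K * ENNReal.ofReal (3 * P.2) * (ENNReal.ofReal ((2 * P.2) ^ n) * v)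
              = K * (ENNReal.ofReal (3 * P.2) * ENNReal.ofReal ((2 * P.2) ^ n)) * v := by ring
            _ = K * (ENNReal.ofReal (6 * 4 ^ n) * ENNReal.ofReal ((P.2 / 2) ^ (n + 1))) *
                (v / unitBallVolume n * unitBallVolume n) := by
                rw [ENNReal.div_mul_cancel hκ hκ', ← ENNReal.ofReal_mul (by positivity),
                  ← ENNReal.ofReal_mul (by positivity)]
                congr 3
                rw [mul_pow, div_pow, pow_succ 2 n, show (4 : ℝ) = 2 * 2 by norm_num, mul_pow]
                field_simp
                ring
            _ = _ := by simp only [K]; ring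

/-! ### Linearisation of finite maxima -/

/-- The pointwise maximum of the finitely many step functions `A k · 1_{U k}`, `k < m`. -/
def stepMax {α : Type*} (U : ℕ → Set α) (A : ℕ → ℝ≥0∞) (m : ℕ) (x : α) : ℝ≥0∞ :=
  (Finset.range m).sup fun k => (U k).indicator (fun _ => A k) x

lemma stepMax_succ {α : Type*} (U : ℕ → Set α) (A : ℕ → ℝ≥0∞) (m : ℕ) (x : α) :
    stepMax U A (m + 1) x = (U m).indicator (fun _ => A m) x ⊔ stepMax U A m x := by
  rw [stepMax, Finset.range_add_one, Finset.sup_insert, stepMax]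

lemma measurable_stepMax {α : Type*} [MeasurableSpace α] {U : ℕ → Set α}
    (hU : ∀ k, MeasurableSet (U k)) (A : ℕ → ℝ≥0∞) (m : ℕ) : Measurable (stepMax U A m) := by
  induction m with
  | zero => exact measurable_const (a := (⊥ : ℝ≥0∞))
  | succ m ih =>
    have : stepMax U A (m + 1) = fun x => (U m).indicator (fun _ => A m) x ⊔ stepMax U A m x :=
      funext fun x => stepMax_succ U A m x
    rw [this]
    exact (measurable_const.indicator (hU m)).sup ih

/-- A finite maximum of step functions is a sum of the same steps over smaller measurable sets that
do not overlap. -/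
lemma exists_partition_stepMax {α : Type*} [MeasurableSpace α] {U : ℕ → Set α}
    (hU : ∀ k, MeasurableSet (U k)) (A : ℕ → ℝ≥0∞) (m : ℕ) :
    ∃ E : ℕ → Set α, (∀ k, MeasurableSet (E k)) ∧ (∀ k, E k ⊆ U k) ∧
      (∀ x, ∑ k ∈ Finset.range m, (E k).indicator (fun _ => (1 : ℝ≥0∞)) x ≤ 1) ∧
      ∀ x, ∑ k ∈ Finset.range m, (E k).indicator (fun _ => A k) x = stepMax U A m x := by
  classical
  induction m with
  | zero => exact ⟨fun _ => ∅, by simp, by simp, by simp, by simp [stepMax]⟩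
  | succ m ih =>
    obtain ⟨E, hE, hEU, hE1, hEA⟩ := ih
    set G : Set α := U m ∩ {x | stepMax U A m x < A m}
    have hG : MeasurableSet G :=
      (hU m).inter (measurableSet_lt (measurable_stepMax hU A m) measurable_const)
    -- The new step wins exactly on `G`, which is removed from the previous sets.
    have hsum : ∀ (c : ℕ → ℝ≥0∞) (x : α), ∑ k ∈ Finset.range (m + 1),
        (if k = m then G else E k \ G).indicator (fun _ => c k) x =
        if x ∈ G then c m else ∑ k ∈ Finset.range m, (E k).indicator (fun _ => c k) x := by
      intro c x
      rw [Finset.sum_range_succ, if_pos rfl]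
      have h1 : ∑ k ∈ Finset.range m, (if k = m then G else E k \ G).indicator (fun _ => c k) x =
          ∑ k ∈ Finset.range m, (E k \ G).indicator (fun _ => c k) x :=
        Finset.sum_congr rfl fun k hk => by rw [if_neg (Finset.mem_range.1 hk).ne]
      rw [h1]
      by_cases hx : x ∈ G
      · simp [hx]
      · simp [hx, indicator_apply]
    refine ⟨fun k => if k = m then G else E k \ G, fun k => ?_, fun k => ?_, fun x => ?_,
      fun x => ?_⟩
    · dsimp only; split_ifs
      exacts [hG, (hE k).diff hG]
    · dsimp only; split_ifs with h
      exacts [h ▸ inter_subset_left, sdiff_subset.trans (hEU k)]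
    · rw [hsum (fun _ => 1) x]
      split_ifs
      exacts [le_rfl, hE1 x]
    · rw [hsum A x, stepMax_succ, hEA x]
      by_cases hxU : x ∈ U m
      · rw [indicator_of_mem hxU]
        by_cases hlt : stepMax U A m x < A m
        · rw [if_pos ⟨hxU, hlt⟩, sup_of_le_left hlt.le]
        · rw [if_neg fun h => hlt h.2, sup_of_le_right (not_lt.1 hlt)]
      · rw [indicator_of_notMem hxU, if_neg fun h => hxU h.1]
        simp

/-- A nontangential maximal function is a supremum of countably many of its step functions. -/
lemma exists_seq_ntMax_eq (g : Space n → ℝ≥0∞) :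
    ∃ P : ℕ → Space n, (∀ k, 0 < (P k).2) ∧ ∀ x, ntMax g x =
      ⨆ m, stepMax (fun k => ball (P k).1 (P k).2) (fun k => g (P k)) m x := by
  -- For each rational level the superlevel set is a countable union of balls, by Lindelöf.
  have hT : ∀ c : ℚ, ∃ T ⊆ {P : Space n | 0 < P.2 ∧ ENNReal.ofReal c < g P}, T.Countable ∧
      ⋃ P ∈ T, ball P.1 P.2 =
        ⋃ P ∈ {P : Space n | 0 < P.2 ∧ ENNReal.ofReal c < g P}, ball P.1 P.2 := fun c =>
    TopologicalSpace.isOpen_biUnion_countable _ _ fun _ _ => isOpen_ball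
  choose T hT hTc hTU using hT
  have hcount : ({((0 : EuclideanSpace ℝ (Fin n)), (1 : ℝ))} ∪ ⋃ c, T c).Countable :=
    (countable_singleton _).union (countable_iUnion hTc)
  obtain ⟨P, hP⟩ := hcount.exists_eq_range ⟨_, Or.inl rfl⟩
  have hpos : ∀ k, 0 < (P k).2 := by
    intro k
    have hk : P k ∈ ({((0 : EuclideanSpace ℝ (Fin n)), (1 : ℝ))} ∪ ⋃ c, T c) :=
      hP ▸ mem_range_self k
    rcases hk with h | h
    · rw [mem_singleton_iff.1 h]; exact one_pos
    · obtain ⟨c, hc⟩ := mem_iUnion.1 h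
      exact (hT c hc).1
  refine ⟨P, hpos, fun x => le_antisymm ?_ ?_⟩
  · refine le_of_forall_lt fun c hc => ?_
    obtain ⟨q, hq0, hcq, hqN⟩ := ENNReal.lt_iff_exists_rat_btwn.1 hc
    obtain ⟨y, s, hs, hxy, hlt⟩ := lt_ntMax_iff.1 hqN
    have hx : x ∈ ⋃ P ∈ T q, ball P.1 P.2 := by
      rw [hTU q]
      exact mem_biUnion (show ((y, s) : Space n) ∈ _ from ⟨hs, hlt⟩) hxy
    obtain ⟨R, hR, hxR⟩ := mem_iUnion₂.1 hx
    obtain ⟨k, rfl⟩ : R ∈ range P := hP ▸ Or.inr (mem_iUnion.2 ⟨q, hR⟩)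
    calc c < ENNReal.ofReal q := hcq
      _ < g (P k) := (hT q hR).2
      _ = (ball (P k).1 (P k).2).indicator (fun _ => g (P k)) x :=
          (indicator_of_mem hxR fun _ => g (P k)).symm
      _ ≤ stepMax (fun k => ball (P k).1 (P k).2) (fun k => g (P k)) (k + 1) x :=
          Finset.le_sup (f := fun k => (ball (P k).1 (P k).2).indicator (fun _ => g (P k)) x)
            (Finset.self_mem_range_succ k)
      _ ≤ _ := le_iSup (fun m => stepMax (fun k => ball (P k).1 (P k).2) (fun k => g (P k)) m x) _
  · refine iSup_le fun m => Finset.sup_le fun k _ => ?_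
    by_cases hx : x ∈ ball (P k).1 (P k).2
    · rw [indicator_of_mem hx]
      exact le_ntMax g (hpos k) hx
    · rw [indicator_of_notMem hx]
      exact zero_le

lemma stepMax_mono {α : Type*} (U : ℕ → Set α) (A : ℕ → ℝ≥0∞) : Monotone (stepMax U A) :=
  fun _ _ h _ => Finset.sup_mono (Finset.range_mono h)

section TestArrays

variable {ι : Type} [Fintype ι]

/-! ### Locally square integrable arrays -/

lemma IsL2Loc.aestronglyMeasurable {u : Space n → EuclideanSpace ℂ ι} (hu : IsL2Loc u) :
    AEStronglyMeasurable u (volume.restrict (upperHalfSpace n)) := by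
  set U : ℕ → Set (Space n) := fun k => ball 0 (k + 1) ∩ {X | 1 / ((k : ℝ) + 1) < X.2}
  have hU : ∀ k, AEStronglyMeasurable u (volume.restrict (U k)) := fun k => by
    refine (hu (U k) (isOpen_ball.inter (isOpen_lt continuous_const continuous_snd))
      (isBounded_ball.subset inter_subset_left) fun X hX => ?_).aestronglyMeasurable
    have h1 : closure (U k) ⊆ {X : Space n | 1 / ((k : ℝ) + 1) ≤ X.2} :=
      closure_minimal (fun X hX => le_of_lt (show 1 / ((k : ℝ) + 1) < X.2 from hX.2))
        (isClosed_le continuous_const continuous_snd)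
    have h2 : 0 < 1 / ((k : ℝ) + 1) := by positivity
    exact h2.trans_le (h1 hX)
  refine (aestronglyMeasurable_iUnion_iff.2 hU).mono_set fun X hX => ?_
  have hX0 : 0 < X.2 := hX
  obtain ⟨k, hk⟩ := exists_nat_gt (max ‖X‖ (1 / X.2))
  refine mem_iUnion.2 ⟨k, ?_, ?_⟩
  · rw [mem_ball_zero_iff]
    linarith [le_max_left ‖X‖ (1 / X.2)]
  · have h3 : 1 / X.2 < (k : ℝ) + 1 := by linarith [le_max_right ‖X‖ (1 / X.2)]
    rw [mem_ofPred_eq, div_lt_comm₀ (by positivity) hX0]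
    exact h3

lemma IsL2Loc.lintegral_whitneyBall_ne_top {u : Space n → EuclideanSpace ℂ ι} (hu : IsL2Loc u)
    {P : Space n} (hP : 0 < P.2) : ∫⁻ Z in whitneyBall P, ‖u Z‖ₑ ^ 2 ≠ ∞ := by
  have h := (hu (whitneyBall P) (isOpen_euclBall _ _ _) (isBounded_euclBall _ _ _)
    (closure_euclBall_subset_upperHalfSpace _ hP)).eLpNorm_lt_top
  rw [eLpNorm_lt_top_iff_lintegral_rpow_enorm_lt_top (by norm_num) (by norm_num)] at h
  simpa using h.ne

lemma IsL2Loc.quadAverage_ne_top {u : Space n → EuclideanSpace ℂ ι} (hu : IsL2Loc u)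
    {P : Space n} (hP : 0 < P.2) : quadAverage (fun Z => ‖u Z‖ₑ) P.1 P.2 ≠ ∞ := by
  rw [quadAverage, setLAverage_eq]
  refine ENNReal.rpow_ne_top_of_nonneg (by norm_num) (ENNReal.div_ne_top ?_ ?_)
  · exact hu.lintegral_whitneyBall_ne_top hP
  · exact volume_euclBall_ne_zero _ _ (half_pos hP)

/-! ### The test arrays -/

/-- The weight `∑ c_k 1_{B_k}`, `k < m`, for the Whitney balls `B_k` of the points `P k`. -/
def testWeight (P : ℕ → Space n) (c : ℕ → ℝ≥0) (m : ℕ) (X : Space n) : ℝ≥0 :=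
  ∑ k ∈ Finset.range m, (whitneyBall (P k)).indicator (fun _ => c k) X

/-- The array `∑ c_k 1_{B_k} u`, `k < m`. -/
def testArray (u : Space n → EuclideanSpace ℂ ι) (P : ℕ → Space n) (c : ℕ → ℝ≥0) (m : ℕ)
    (X : Space n) : EuclideanSpace ℂ ι :=
  ((testWeight P c m X : ℝ) : ℂ) • u X

variable {P : ℕ → Space n} {c : ℕ → ℝ≥0} {m : ℕ}

lemma measurable_testWeight : Measurable (testWeight P c m) :=
  Finset.measurable_fun_sum _ fun _ _ => measurable_const.indicator (measurableSet_euclBall _ _ _)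

lemma coe_testWeight (X : Space n) : (testWeight P c m X : ℝ≥0∞) =
    ∑ k ∈ Finset.range m, (whitneyBall (P k)).indicator (fun _ => (c k : ℝ≥0∞)) X := by
  rw [testWeight, ENNReal.ofNNReal_finsetSum]
  refine Finset.sum_congr rfl fun k _ => ?_
  by_cases h : X ∈ whitneyBall (P k) <;> simp [h]

lemma testWeight_le (X : Space n) : testWeight P c m X ≤ ∑ k ∈ Finset.range m, c k :=
  Finset.sum_le_sum fun _ _ => indicator_le_self _ _ _

lemma enorm_testArray (u : Space n → EuclideanSpace ℂ ι) (X : Space n) :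
    ‖testArray u P c m X‖ₑ = testWeight P c m X * ‖u X‖ₑ := by
  rw [testArray, enorm_smul]
  congr 1
  rw [← ofReal_norm, Complex.norm_real, Real.norm_of_nonneg (NNReal.coe_nonneg _),
    ENNReal.ofReal_coe_nnreal]

lemma aestronglyMeasurable_testArray {u : Space n → EuclideanSpace ℂ ι} (hu : IsL2Loc u) :
    AEStronglyMeasurable (testArray u P c m) (volume.restrict (upperHalfSpace n)) :=
  (Complex.measurable_ofReal.comp
    measurable_testWeight.coe_nnreal_real).aestronglyMeasurable.smul hu.aestronglyMeasurable

/-- The mass of `|u| |H|` for a test array `H`. -/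
lemma lintegral_testWeight_mul {u : Space n → EuclideanSpace ℂ ι} (hu : IsL2Loc u) :
    ∫⁻ X in upperHalfSpace n, testWeight P c m X * ‖u X‖ₑ ^ 2 =
      ∑ k ∈ Finset.range m, c k * ∫⁻ X in whitneyBall (P k), ‖u X‖ₑ ^ 2 := by
  have hum : AEMeasurable (fun X => ‖u X‖ₑ ^ 2) (volume.restrict (upperHalfSpace n)) :=
    hu.aestronglyMeasurable.enorm.pow_const 2
  have hB : ∀ k, MeasurableSet (whitneyBall (P k)) := fun k => measurableSet_euclBall _ _ _
  calc _ = ∫⁻ X in upperHalfSpace n, ∑ k ∈ Finset.range m,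
        c k * (whitneyBall (P k)).indicator (fun X => ‖u X‖ₑ ^ 2) X := by
        refine lintegral_congr fun X => ?_
        rw [coe_testWeight, Finset.sum_mul]
        refine Finset.sum_congr rfl fun k _ => ?_
        by_cases h : X ∈ whitneyBall (P k) <;> simp [h]
    _ = ∑ k ∈ Finset.range m, ∫⁻ X in upperHalfSpace n,
        c k * (whitneyBall (P k)).indicator (fun X => ‖u X‖ₑ ^ 2) X :=
        lintegral_finsetSum' _ fun k _ => (hum.indicator (hB k)).const_mul _
    _ = _ := by
        refine Finset.sum_congr rfl fun k _ => ?_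
        rw [lintegral_const_mul' _ _ ENNReal.coe_ne_top, lintegral_indicator (hB k),
          Measure.restrict_restrict (hB k),
          inter_eq_self_of_subset_left
            (show whitneyBall (P k) ⊆ _ from euclBall_subset_upperHalfSpace _ _)]

lemma lintegral_testWeight_mul_ne_top {u : Space n → EuclideanSpace ℂ ι} (hu : IsL2Loc u)
    (hP : ∀ k, 0 < (P k).2) :
    ∫⁻ X in upperHalfSpace n, testWeight P c m X * ‖u X‖ₑ ^ 2 ≠ ∞ := by
  rw [lintegral_testWeight_mul hu]
  exact ENNReal.sum_ne_top.2 fun k _ =>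
    ENNReal.mul_ne_top ENNReal.coe_ne_top (hu.lintegral_whitneyBall_ne_top (hP k))

lemma isL2c_testArray {u : Space n → EuclideanSpace ℂ ι} (hu : IsL2Loc u)
    (hP : ∀ k, 0 < (P k).2) : IsL2c (testArray u P c m) := by
  refine ⟨⟨aestronglyMeasurable_testArray hu, ?_⟩,
    ⋃ k ∈ Finset.range m, closure (whitneyBall (P k)), ?_, ?_, ?_⟩
  · rw [eLpNorm_lt_top_iff_lintegral_rpow_enorm_lt_top (by norm_num) (by norm_num)]
    simp only [ENNReal.toReal_ofNat, ENNReal.rpow_ofNat]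
    calc ∫⁻ X in upperHalfSpace n, ‖testArray u P c m X‖ₑ ^ 2
        ≤ ∫⁻ X in upperHalfSpace n, ((∑ k ∈ Finset.range m, c k : ℝ≥0) : ℝ≥0∞) *
            (testWeight P c m X * ‖u X‖ₑ ^ 2) := by
          refine lintegral_mono fun X => ?_
          rw [enorm_testArray, mul_pow, sq (testWeight P c m X : ℝ≥0∞), mul_assoc]
          gcongr
          exact testWeight_le X
      _ < ∞ := by
          rw [lintegral_const_mul' _ _ ENNReal.coe_ne_top]
          exact (ENNReal.mul_ne_top ENNReal.coe_ne_top
            (lintegral_testWeight_mul_ne_top hu hP)).lt_top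
  · exact (Finset.range m).isCompact_biUnion fun k _ =>
      (isBounded_euclBall _ _ _).isCompact_closure
  · exact iUnion₂_subset fun k _ => closure_euclBall_subset_upperHalfSpace _ (hP k)
  · refine Filter.Eventually.of_forall fun X hX => ?_
    have h0 : testWeight P c m X = 0 := Finset.sum_eq_zero fun k hk =>
      indicator_of_notMem (fun h => hX (mem_biUnion (Finset.mem_coe.2 hk) (subset_closure h))) _
    simp [testArray, h0]

/-- The pairing of `u` with a test array. -/
lemma enorm_pairing_testArray {u : Space n → EuclideanSpace ℂ ι} (hu : IsL2Loc u)
    (hP : ∀ k, 0 < (P k).2) : ‖pairing u (testArray u P c m)‖ₑ =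
      ∑ k ∈ Finset.range m, c k * ∫⁻ X in whitneyBall (P k), ‖u X‖ₑ ^ 2 := by
  have hfin := lintegral_testWeight_mul_ne_top (m := m) (c := c) hu hP
  have e : ∀ X, ‖u X‖ₑ * ‖testArray u P c m X‖ₑ = testWeight P c m X * ‖u X‖ₑ ^ 2 := fun X => by
    rw [enorm_testArray]; ring
  have hint := integrableOn_conj_mul hu.aestronglyMeasurable
    (aestronglyMeasurable_testArray (P := P) (c := c) (m := m) hu)
    (by rw [lintegral_congr e]; exact hfin.lt_top)
  rw [pairing_eq_integral_inner hint]
  have e2 : ∀ X, inner ℂ (u X) (testArray u P c m X) =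
      ((testWeight P c m X * ‖u X‖ ^ 2 : ℝ) : ℂ) := fun X => by
    rw [testArray, inner_smul_right, inner_self_eq_norm_sq_to_K]
    push_cast; rfl
  have e3 : ∀ X, ENNReal.ofReal (testWeight P c m X * ‖u X‖ ^ 2) =
      testWeight P c m X * ‖u X‖ₑ ^ 2 := fun X => by
    rw [ENNReal.ofReal_mul (NNReal.coe_nonneg _), ENNReal.ofReal_coe_nnreal,
      ENNReal.ofReal_pow (norm_nonneg _), ofReal_norm]
  simp_rw [e2]
  rw [integral_complex_ofReal, ← ofReal_norm, Complex.norm_real,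
    Real.norm_of_nonneg (integral_nonneg fun X => by positivity),
    integral_eq_lintegral_of_nonneg_ae (Filter.Eventually.of_forall fun X => by positivity)]
  · simp_rw [e3]
    rw [ENNReal.ofReal_toReal hfin, lintegral_testWeight_mul hu]
  · exact measurable_testWeight.coe_nnreal_real.aestronglyMeasurable.mul
      (hu.aestronglyMeasurable.norm.pow 2)

/-! ### The Carleson function of a test array -/

/-- Integrals over sets that do not overlap add up to at most the integral over a set containing
them. -/
lemma sum_setLIntegral_le {α : Type*} [MeasurableSpace α] {μ : Measure α} {E : ℕ → Set α}
    (hE : ∀ k, MeasurableSet (E k)) {m : ℕ}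
    (hE1 : ∀ x, ∑ k ∈ Finset.range m, (E k).indicator (fun _ => (1 : ℝ≥0∞)) x ≤ 1)
    {h : α → ℝ≥0∞} (hh : Measurable h) {B : Set α} (hB : MeasurableSet B) {S : Finset ℕ}
    (hS : S ⊆ Finset.range m) (hEB : ∀ k ∈ S, E k ⊆ B) :
    ∑ k ∈ S, ∫⁻ x in E k, h x ∂μ ≤ ∫⁻ x in B, h x ∂μ := by
  calc ∑ k ∈ S, ∫⁻ x in E k, h x ∂μ = ∑ k ∈ S, ∫⁻ x, (E k).indicator h x ∂μ :=
        Finset.sum_congr rfl fun k _ => (lintegral_indicator (hE k) _).symm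
    _ = ∫⁻ x, ∑ k ∈ S, (E k).indicator h x ∂μ :=
        (lintegral_finsetSum _ fun k _ => hh.indicator (hE k)).symm
    _ ≤ ∫⁻ x, B.indicator h x ∂μ := by
        refine lintegral_mono fun x => ?_
        by_cases hx : x ∈ B
        · rw [indicator_of_mem hx]
          calc ∑ k ∈ S, (E k).indicator h x
              ≤ ∑ k ∈ Finset.range m, (E k).indicator h x := Finset.sum_le_sum_of_subset hS
            _ = (∑ k ∈ Finset.range m, (E k).indicator (fun _ => (1 : ℝ≥0∞)) x) * h x := by
                rw [Finset.sum_mul]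
                refine Finset.sum_congr rfl fun k _ => ?_
                by_cases hk : x ∈ E k <;> simp [hk]
            _ ≤ h x := mul_le_of_le_one_left' (hE1 x)
        · rw [indicator_of_notMem hx, Finset.sum_eq_zero]
          exact fun k hk => indicator_of_notMem (fun hxk => hx (hEB k hk hxk)) _
    _ = _ := lintegral_indicator hB _

/-- A variant of `sum_setLIntegral_le` for terms that either vanish or are localised in `B`. -/
lemma sum_mul_le_of_localized {α : Type*} [MeasurableSpace α] {μ : Measure α} {E : ℕ → Set α}
    (hE : ∀ k, MeasurableSet (E k)) {m : ℕ}
    (hE1 : ∀ x, ∑ k ∈ Finset.range m, (E k).indicator (fun _ => (1 : ℝ≥0∞)) x ≤ 1)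
    {h : α → ℝ≥0∞} (hh : Measurable h) {B : Set α} (hB : MeasurableSet B) {c : ℕ → ℝ≥0}
    {J : ℕ → ℝ≥0∞} {K : ℝ≥0∞}
    (hJ : ∀ k, J k ≠ 0 → E k ⊆ B ∧ c k * J k ≤ K * ∫⁻ x in E k, h x ∂μ) :
    ∑ k ∈ Finset.range m, c k * J k ≤ K * ∫⁻ x in B, h x ∂μ := by
  classical
  calc ∑ k ∈ Finset.range m, c k * J k
      = ∑ k ∈ Finset.range m with J k ≠ 0, c k * J k :=
        (Finset.sum_filter_of_ne fun k _ (hk : c k * J k ≠ 0) => right_ne_zero_of_mul hk).symm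
    _ ≤ ∑ k ∈ Finset.range m with J k ≠ 0, K * ∫⁻ x in E k, h x ∂μ :=
        Finset.sum_le_sum fun k hk => (hJ k (Finset.mem_filter.1 hk).2).2
    _ ≤ _ := by
        rw [← Finset.mul_sum]
        gcongr _ * ?_
        exact sum_setLIntegral_le hE hE1 hh hB (Finset.filter_subset _ _)
          fun k hk => (hJ k (Finset.mem_filter.1 hk).2).1

/-- The constant in the bound of the Carleson function of a test array by a maximal function. -/
def carlesonConst (n : ℕ) : ℝ≥0∞ :=
  massConst n * (ENNReal.ofReal ((n + 9) ^ n) *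
    volume (ball (0 : EuclideanSpace ℝ (Fin n)) 1))

lemma carlesonConst_ne_top : carlesonConst n ≠ ∞ :=
  ENNReal.mul_ne_top massConst_ne_top
    (ENNReal.mul_ne_top ENNReal.ofReal_ne_top measure_ball_lt_top.ne)

/-- The quadratic average of `t H` for a test array `H` is at most the sum of those of its
Whitney pieces. -/
lemma ballAverage_tMul_testArray_le {u : Space n → EuclideanSpace ℂ ι} {f : Space n → ℝ≥0∞}
    (hf : Measurable f) (huf : (fun Z => ‖u Z‖ₑ) =ᵐ[volume.restrict (upperHalfSpace n)] f)
    (y : EuclideanSpace ℝ (Fin n)) (s : ℝ) :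
    ballAverage (tMul (testArray u P c m)) y s / ENNReal.ofReal s ≤
      ∑ k ∈ Finset.range m, c k *
        (quadAverage (whitneyPiece f (P k)) y s / ENNReal.ofReal s) := by
  have e : (fun Z => ‖tMul (testArray u P c m) Z‖ₑ) =ᵐ[volume.restrict (upperHalfSpace n)]
      fun Z => ∑ k ∈ Finset.range m, c k * whitneyPiece f (P k) Z := by
    filter_upwards [huf, ae_restrict_mem measurableSet_upperHalfSpace] with Z h1 h2
    rw [enorm_tMul _ h2, enorm_testArray, coe_testWeight, h1, Finset.sum_mul, Finset.mul_sum]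
    refine Finset.sum_congr rfl fun k _ => ?_
    by_cases hk : Z ∈ whitneyBall (P k)
    · simp only [whitneyPiece, indicator_of_mem hk]; ring
    · simp [whitneyPiece, hk]
  rw [ballAverage_eq_quadAverage, quadAverage_congr_ae e]
  calc _ ≤ (∑ k ∈ Finset.range m, quadAverage (fun Z => c k * whitneyPiece f (P k) Z) y s)
        / ENNReal.ofReal s := by
        gcongr
        exact quadAverage_sum_le _ (fun k => (measurable_whitneyPiece hf _).const_mul _) y s
    _ = _ := by
        rw [div_eq_mul_inv, Finset.sum_mul]
        refine Finset.sum_congr rfl fun k _ => ?_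
        rw [quadAverage_const_mul (measurable_whitneyPiece hf _), div_eq_mul_inv, mul_assoc]

lemma lintegral_box_sum {G : ℕ → Space n → ℝ≥0∞} (hG : ∀ k, Measurable (G k))
    (Q : Set (EuclideanSpace ℝ (Fin n))) (I : Set ℝ) :
    ∫⁻ y in Q, ∫⁻ s in I, ∑ k ∈ Finset.range m, c k * G k (y, s) =
      ∑ k ∈ Finset.range m, c k * ∫⁻ y in Q, ∫⁻ s in I, G k (y, s) := by
  have h1 : ∀ k y, Measurable fun s : ℝ => G k (y, s) := fun k y =>
    (hG k).comp measurable_prodMk_left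
  have h2 : ∀ k, Measurable fun y => ∫⁻ s in I, G k (y, s) := fun k =>
    (hG k).lintegral_prod_right'
  calc _ = ∫⁻ y in Q, ∑ k ∈ Finset.range m, c k * ∫⁻ s in I, G k (y, s) := by
        refine lintegral_congr fun y => ?_
        rw [lintegral_finsetSum _ fun k _ => (h1 k y).const_mul _]
        exact Finset.sum_congr rfl fun k _ => lintegral_const_mul _ (h1 k y)
    _ = _ := by
        rw [lintegral_finsetSum _ fun k _ => (h2 k).const_mul _]
        exact Finset.sum_congr rfl fun k _ => lintegral_const_mul _ (h2 k)

/-- If the coefficients of a test array are dominated by the integrals of `h` over the sets `E k`,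
then its Carleson function is dominated by the maximal function of `h`: the Whitney balls that
matter for a cube `Q` have `E k` in a fixed dilate of `Q`. -/
lemma avgCarleson_testArray_le (hn : 1 ≤ n) {u : Space n → EuclideanSpace ℂ ι} (hu : IsL2Loc u)
    (hP : ∀ k, 0 < (P k).2) {E : ℕ → Set (EuclideanSpace ℝ (Fin n))}
    (hE : ∀ k, MeasurableSet (E k)) (hEU : ∀ k, E k ⊆ ball (P k).1 (P k).2)
    (hE1 : ∀ x, ∑ k ∈ Finset.range m, (E k).indicator (fun _ => (1 : ℝ≥0∞)) x ≤ 1)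
    {h : EuclideanSpace ℝ (Fin n) → ℝ≥0∞} (hh : Measurable h)
    (hc : ∀ k, c k * (volume (whitneyBall (P k)) *
      quadAverage (fun Z => ‖u Z‖ₑ) (P k).1 (P k).2) ≤ ∫⁻ x in E k, h x)
    (x : EuclideanSpace ℝ (Fin n)) :
    avgCarleson (tMul (testArray u P c m)) x ≤ carlesonConst n * hlMax h x := by
  obtain ⟨f, hf, huf⟩ := hu.aestronglyMeasurable.enorm
  have hA : ∀ k, quadAverage (fun Z => ‖u Z‖ₑ) (P k).1 (P k).2 =
      quadAverage f (P k).1 (P k).2 := fun k => quadAverage_congr_ae huf _ _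
  simp_rw [hA] at hc
  have hpm : ∀ k, Measurable fun Q : Space n =>
      quadAverage (whitneyPiece f (P k)) Q.1 Q.2 / ENNReal.ofReal Q.2 := fun k =>
    (measurable_quadAverage (measurable_whitneyPiece hf _)).div
      (ENNReal.measurable_ofReal.comp measurable_snd)
  refine iSup_le fun a => iSup_le fun ℓ => iSup_le fun hℓ => iSup_le fun hx => ?_
  set J : ℕ → ℝ≥0∞ := fun k => ∫⁻ y in cube a ℓ, ∫⁻ s in Ioo 0 ℓ,
    quadAverage (whitneyPiece f (P k)) y s / ENNReal.ofReal s
  set B := ball x ((n + 9) * ℓ)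
  have hρ : 0 < ((n : ℝ) + 9) * ℓ := by positivity
  have hbox : ∫⁻ y in cube a ℓ, ∫⁻ s in Ioo 0 ℓ,
      ballAverage (tMul (testArray u P c m)) y s / ENNReal.ofReal s ≤
        massConst n * ∫⁻ z in B, h z := by
    calc _ ≤ ∫⁻ y in cube a ℓ, ∫⁻ s in Ioo 0 ℓ, ∑ k ∈ Finset.range m, c k *
            (quadAverage (whitneyPiece f (P k)) y s / ENNReal.ofReal s) :=
          lintegral_mono fun y => lintegral_mono fun s => ballAverage_tMul_testArray_le hf huf y s
      _ = ∑ k ∈ Finset.range m, c k * J k := lintegral_box_sum hpm _ _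
      _ ≤ _ := by
          refine sum_mul_le_of_localized hE hE1 hh measurableSet_ball fun k hk => ?_
          obtain ⟨h1, h2⟩ := lintegral_whitneyPiece_le hn hf (hP k) hx hk
          refine ⟨(hEU k).trans h1, ?_⟩
          calc c k * J k ≤ c k * (massConst n *
                (volume (whitneyBall (P k)) * quadAverage f (P k).1 (P k).2)) :=
                mul_le_mul_right h2 _
            _ = massConst n * (c k *
                (volume (whitneyBall (P k)) * quadAverage f (P k).1 (P k).2)) := by ring
            _ ≤ _ := mul_le_mul_right (hc k) _
  have hvol : (volume (cube a ℓ))⁻¹ = ENNReal.ofReal ((n + 9) ^ n) *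
      volume (ball (0 : EuclideanSpace ℝ (Fin n)) 1) * (volume B)⁻¹ := by
    have e : volume B = ENNReal.ofReal ((n + 9) ^ n) *
        volume (ball (0 : EuclideanSpace ℝ (Fin n)) 1) * volume (cube a ℓ) := by
      rw [volume_ball_eq _ hρ, volume_cube, mul_pow, ENNReal.ofReal_mul (by positivity),
        ENNReal.ofReal_pow hℓ.le]
      ring
    have h0 : ENNReal.ofReal ((n + 9) ^ n) *
        volume (ball (0 : EuclideanSpace ℝ (Fin n)) 1) ≠ 0 :=
      mul_ne_zero (ENNReal.ofReal_pos.2 (by positivity)).ne' (measure_ball_pos volume _ one_pos).ne'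
    have ht : ENNReal.ofReal ((n + 9) ^ n) *
        volume (ball (0 : EuclideanSpace ℝ (Fin n)) 1) ≠ ∞ :=
      ENNReal.mul_ne_top ENNReal.ofReal_ne_top measure_ball_lt_top.ne
    rw [e, ENNReal.mul_inv (Or.inl h0) (Or.inl ht), ← mul_assoc, ENNReal.mul_inv_cancel h0 ht,
      one_mul]
  calc (volume (cube a ℓ))⁻¹ * ∫⁻ y in cube a ℓ, ∫⁻ s in Ioo 0 ℓ,
        ballAverage (tMul (testArray u P c m)) y s / ENNReal.ofReal s
      ≤ (volume (cube a ℓ))⁻¹ * (massConst n * ∫⁻ z in B, h z) := by gcongr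
    _ = carlesonConst n * ((volume B)⁻¹ * ∫⁻ z in B, h z) := by
        rw [hvol, carlesonConst]; ring
    _ ≤ _ := by
        gcongr
        exact le_hlMax h hρ (by rw [dist_self]; exact hρ)

/-! ### The lower bound for the pairing -/

lemma stepMax_ne_top {α : Type*} (U : ℕ → Set α) {A : ℕ → ℝ≥0∞} (hA : ∀ k, A k ≠ ∞) (m : ℕ)
    (x : α) : stepMax U A m x ≠ ∞ := by
  refine ((Finset.sup_lt_iff ENNReal.zero_lt_top).2 fun k _ => ?_).ne
  exact (indicator_le_self (U k) (fun _ => A k) x).trans_lt (hA k).lt_top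

lemma lintegral_stepMax_rpow_ne_top {α : Type*} [MeasurableSpace α] {μ : Measure α}
    {U : ℕ → Set α} (hU : ∀ k, MeasurableSet (U k)) (hUfin : ∀ k, μ (U k) ≠ ∞) {A : ℕ → ℝ≥0∞}
    (hA : ∀ k, A k ≠ ∞) (m : ℕ) {r : ℝ} (hr : 0 < r) : ∫⁻ x, stepMax U A m x ^ r ∂μ ≠ ∞ := by
  induction m with
  | zero => simp [stepMax, hr]
  | succ m ih =>
    have hle : ∀ x, stepMax U A (m + 1) x ^ r ≤
        (U m).indicator (fun _ => A m ^ r) x + stepMax U A m x ^ r := by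
      intro x
      rw [stepMax_succ]
      have hind : (U m).indicator (fun _ => A m) x ^ r = (U m).indicator (fun _ => A m ^ r) x := by
        by_cases hx : x ∈ U m <;> simp [hx, hr]
      rw [← hind]
      rcases le_total ((U m).indicator (fun _ => A m) x) (stepMax U A m x) with h | h
      · rw [sup_of_le_right h]; exact le_add_self
      · rw [sup_of_le_left h]; exact le_self_add
    refine ne_top_of_le_ne_top ?_ (lintegral_mono hle)
    rw [lintegral_add_left (measurable_const.indicator (hU m)), lintegral_indicator_const (hU m)]
    exact ENNReal.add_ne_top.2 ⟨ENNReal.mul_ne_top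
      (ENNReal.rpow_ne_top_of_nonneg hr.le (hA m)) (hUfin m), ih⟩

/-- The defining inequality of the dual norm, cleared of the division. -/
lemma enorm_pairing_le_dualSup_mul {q : ℝ} {u H : Space n → EuclideanSpace ℂ ι} (hH : IsL2c H)
    (hD : dualSup q u ≠ ∞)
    (hC : eLpNorm (avgCarleson (tMul H)) (ENNReal.ofReal q) volume ≠ ∞) :
    ‖pairing u H‖ₑ ≤ dualSup q u * eLpNorm (avgCarleson (tMul H)) (ENNReal.ofReal q) volume := by
  by_cases h0 : H =ᵐ[volume.restrict (upperHalfSpace n)] 0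
  · have : pairing u H = 0 := by
      refine Finset.sum_eq_zero fun j _ => integral_eq_zero_of_ae ?_
      filter_upwards [h0] with X hX
      simp [hX]
    simp [this]
  · rw [← ENNReal.div_le_iff_le_mul (Or.inr hD) (Or.inl hC)]
    exact le_iSup_of_le H <| le_iSup_of_le hH <| le_iSup_of_le h0 le_rfl

/-- The constant in the lower bound for the pairing. -/
def dualConst (n : ℕ) (q : ℝ) : ℝ≥0∞ := carlesonConst n * hlConst n q ^ (1 / q)

lemma dualConst_ne_top {q : ℝ} (hq : 1 < q) : dualConst n q ≠ ∞ :=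
  ENNReal.mul_ne_top carlesonConst_ne_top
    (ENNReal.rpow_ne_top_of_nonneg (by positivity) (hlConst_ne_top hq))

/-- The lower bound for a finite maximum `N` of steps: the test array built from the weight
`h = N^{p-1}` pairs with `u` to `∫ N^p`, and its Carleson function is dominated by the maximal
function of `h`, where `∫ h^q = ∫ N^p`. -/
lemma lintegral_stepMax_rpow_le (hn : 1 ≤ n) {p q : ℝ} (hpq : p.HolderConjugate q)
    {u : Space n → EuclideanSpace ℂ ι} (hu : IsL2Loc u) (hD : dualSup q u ≠ ∞)
    {P : ℕ → Space n} (hP : ∀ k, 0 < (P k).2) (m : ℕ) :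
    ∫⁻ x, stepMax (fun k => ball (P k).1 (P k).2)
      (fun k => quadAverage (fun Z => ‖u Z‖ₑ) (P k).1 (P k).2) m x ^ p
      ≤ (dualConst n q * dualSup q u) ^ p := by
  set A : ℕ → ℝ≥0∞ := fun k => quadAverage (fun Z => ‖u Z‖ₑ) (P k).1 (P k).2
  set U : ℕ → Set (EuclideanSpace ℝ (Fin n)) := fun k => ball (P k).1 (P k).2
  set N := stepMax U A m
  set V : ℕ → ℝ≥0∞ := fun k => volume (whitneyBall (P k))
  have hA : ∀ k, A k ≠ ∞ := fun k => hu.quadAverage_ne_top (hP k)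
  have hU : ∀ k, MeasurableSet (U k) := fun k => measurableSet_ball
  have hUfin : ∀ k, volume (U k) ≠ ∞ := fun k => measure_ball_lt_top.ne
  have hV0 : ∀ k, V k ≠ 0 := fun k => volume_euclBall_ne_zero _ _ (half_pos (hP k))
  have hVt : ∀ k, V k ≠ ∞ := fun k => volume_euclBall_ne_top _ _ _
  have hp := hpq.pos
  have hq := hpq.symm.pos
  have hp1 : 0 < p - 1 := hpq.sub_one_pos
  have hN : Measurable N := measurable_stepMax hU A m
  have hNfin : ∀ x, N x ≠ ∞ := stepMax_ne_top U hA m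
  set h : EuclideanSpace ℝ (Fin n) → ℝ≥0∞ := fun x => N x ^ (p - 1)
  have hh : Measurable h := hN.pow_const _
  have hhfin : ∀ x, h x ≠ ∞ := fun x => ENNReal.rpow_ne_top_of_nonneg hp1.le (hNfin x)
  have hhint : ∫⁻ x, h x ≠ ∞ := lintegral_stepMax_rpow_ne_top hU hUfin hA m hp1
  set X := ∫⁻ x, N x ^ p
  have hX : X ≠ ∞ := lintegral_stepMax_rpow_ne_top hU hUfin hA m hp
  have hhq : ∫⁻ x, h x ^ q = X := lintegral_congr fun x => by
    simp only [h]
    rw [← ENNReal.rpow_mul, hpq.sub_one_mul_conj]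
  obtain ⟨E, hE, hEU, hE1, hEA⟩ := exists_partition_stepMax hU A m
  set w : ℕ → ℝ≥0∞ := fun k => ∫⁻ x in E k, h x
  have hw : ∀ k, w k ≠ ∞ := fun k => ne_top_of_le_ne_top hhint (setLIntegral_le_lintegral _ _)
  -- If `A k = 0` the quotient is `0` or `∞`, and the coefficient is `0` in both cases.
  set c : ℕ → ℝ≥0 := fun k => (w k / (V k * A k)).toNNReal
  have hc : ∀ k, A k ≠ 0 → c k * (V k * A k) = w k := by
    intro k hk
    have hVA : V k * A k ≠ 0 := mul_ne_zero (hV0 k) hk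
    rw [ENNReal.coe_toNNReal (ENNReal.div_ne_top (hw k) hVA),
      ENNReal.div_mul_cancel hVA (ENNReal.mul_ne_top (hVt k) (hA k))]
  have hc1 : ∀ k, c k * (V k * A k) ≤ w k := by
    intro k
    by_cases hk : A k = 0
    · simp [hk]
    · exact (hc k hk).le
  have hc2 : ∀ k, c k * ∫⁻ Z in whitneyBall (P k), ‖u Z‖ₑ ^ 2 = A k * w k := by
    intro k
    have e : ∫⁻ Z in whitneyBall (P k), ‖u Z‖ₑ ^ 2 = V k * A k ^ 2 :=
      setLIntegral_sq_eq_quadAverage _ _ _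
    rw [e]
    by_cases hk : A k = 0
    · simp [hk]
    · rw [← hc k hk]; ring
  have hpair : ‖pairing u (testArray u P c m)‖ₑ = X := by
    rw [enorm_pairing_testArray hu hP]
    calc _ = ∑ k ∈ Finset.range m, ∫⁻ x, A k * (E k).indicator h x := by
          refine Finset.sum_congr rfl fun k _ => ?_
          rw [hc2, lintegral_const_mul _ (hh.indicator (hE k)), lintegral_indicator (hE k)]
      _ = ∫⁻ x, ∑ k ∈ Finset.range m, A k * (E k).indicator h x :=
          (lintegral_finsetSum _ fun k _ => (hh.indicator (hE k)).const_mul _).symm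
      _ = X := by
          refine lintegral_congr fun x => ?_
          have e : N x ^ p = N x * N x ^ (p - 1) := by
            conv_lhs => rw [show p = 1 + (p - 1) by ring,
              ENNReal.rpow_add_of_nonneg _ _ zero_le_one hp1.le, ENNReal.rpow_one]
          rw [e, show N x * N x ^ (p - 1) = stepMax U A m x * h x from rfl, ← hEA x, Finset.sum_mul]
          refine Finset.sum_congr rfl fun k _ => ?_
          by_cases hk : x ∈ E k
          · simp only [indicator_of_mem hk]
          · simp [indicator_of_notMem hk]
  have hnorm : eLpNorm (avgCarleson (tMul (testArray u P c m))) (ENNReal.ofReal q) volume ≤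
      dualConst n q * X ^ (1 / q) := by
    rw [eLpNorm_ofReal_eq_lintegral _ hq]
    calc (∫⁻ x, avgCarleson (tMul (testArray u P c m)) x ^ q) ^ (1 / q)
        ≤ (∫⁻ x, carlesonConst n ^ q * hlMax h x ^ q) ^ (1 / q) := by
          refine ENNReal.rpow_le_rpow (lintegral_mono fun x => ?_) (by positivity)
          rw [← ENNReal.mul_rpow_of_nonneg _ _ hq.le]
          exact ENNReal.rpow_le_rpow
            (avgCarleson_testArray_le hn hu hP hE hEU hE1 hh hc1 x) hq.le
      _ ≤ (carlesonConst n ^ q * (hlConst n q * X)) ^ (1 / q) := by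
          refine ENNReal.rpow_le_rpow ?_ (by positivity)
          rw [lintegral_const_mul _ ((measurable_hlMax h).pow_const q), ← hhq]
          exact mul_le_mul_right (lintegral_hlMax_rpow_le hn hpq.symm.lt hh hhfin hhint) _
      _ = _ := by
          have hq' : 0 ≤ 1 / q := by positivity
          rw [ENNReal.mul_rpow_of_nonneg _ _ hq', ENNReal.mul_rpow_of_nonneg _ _ hq',
            ← ENNReal.rpow_mul, mul_one_div_cancel hq.ne', ENNReal.rpow_one, dualConst, mul_assoc]
  have hXq : X ^ (1 / q) ≠ ∞ := ENNReal.rpow_ne_top_of_nonneg (by positivity) hX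
  have hmain : X ≤ dualConst n q * dualSup q u * X ^ (1 / q) := by
    have h1 := enorm_pairing_le_dualSup_mul (isL2c_testArray (c := c) (m := m) hu hP) hD
      (ne_top_of_le_ne_top (ENNReal.mul_ne_top (dualConst_ne_top hpq.symm.lt) hXq) hnorm)
    rw [hpair] at h1
    calc X ≤ dualSup q u * (dualConst n q * X ^ (1 / q)) := h1.trans (mul_le_mul_right hnorm _)
      _ = _ := by ring
  -- Divide by `X ^ (1 / q)`, which is finite.
  by_cases hX0 : X = 0
  · rw [hX0]; exact zero_le
  have hXq0 : X ^ (1 / q) ≠ 0 := (ENNReal.rpow_pos (pos_iff_ne_zero.2 hX0) hX).ne'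
  have hXp : X ^ (1 / p) ≤ dualConst n q * dualSup q u := by
    refine (ENNReal.mul_le_mul_iff_left hXq0 hXq).1 (le_trans (le_of_eq ?_) hmain)
    rw [← ENNReal.rpow_add _ _ hX0 hX, one_div, one_div, hpq.inv_add_inv_eq_one, ENNReal.rpow_one]
  calc X = (X ^ (1 / p)) ^ p := by
        rw [← ENNReal.rpow_mul, one_div_mul_cancel hp.ne', ENNReal.rpow_one]
    _ ≤ _ := ENNReal.rpow_le_rpow hXp hp.le

/-- The lower bound for the pairing, by monotone convergence from finite maxima. -/
lemma eLpNorm_modNT_le (hn : 1 ≤ n) {p q : ℝ} (hpq : p.HolderConjugate q)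
    {u : Space n → EuclideanSpace ℂ ι} (hu : IsL2Loc u) (hD : dualSup q u ≠ ∞) :
    eLpNorm (modNT u) (ENNReal.ofReal p) volume ≤ dualConst n q * dualSup q u := by
  have hp := hpq.pos
  obtain ⟨P, hP, hsup⟩ :=
    exists_seq_ntMax_eq fun Q : Space n => quadAverage (fun Z => ‖u Z‖ₑ) Q.1 Q.2
  rw [eLpNorm_ofReal_eq_lintegral _ hp, one_div, ENNReal.rpow_inv_le_iff hp, modNT_eq_ntMax]
  set N := stepMax (fun k => ball (P k).1 (P k).2)
    (fun k => quadAverage (fun Z => ‖u Z‖ₑ) (P k).1 (P k).2)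
  have e : ∀ x, (⨆ m, N m x) ^ p = ⨆ m, N m x ^ p := fun x =>
    (ENNReal.orderIsoRpow p hp).map_iSup _
  simp_rw [hsup, e]
  have hN : ∀ m, Measurable fun x => N m x ^ p := fun m =>
    (measurable_stepMax (fun k => measurableSet_ball) _ m).pow_const p
  rw [lintegral_iSup hN fun i j hij x => ENNReal.rpow_le_rpow (stepMax_mono _ _ hij x) hp.le]
  exact iSup_le fun m => lintegral_stepMax_rpow_le hn hpq hu hD hP m

end TestArrays

end TentDuality

end

theorem mainTheorem6 (n : ℕ) (hn : 1 ≤ n) :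
    (∀ p q : ℝ, p.HolderConjugate q →
      ∃ Cp : ℝ≥0, ∀ (ι : Type) [Fintype ι] (u : TentDuality.Space n → EuclideanSpace ℂ ι),
        TentDuality.IsL2Loc u →
        TentDuality.dualSup q u ≠ ∞ →
        eLpNorm (TentDuality.modNT u) (ENNReal.ofReal p) volume
          ≤ Cp * TentDuality.dualSup q u) ∧
    (∃ C : ℝ≥0, ∀ p q : ℝ, p.HolderConjugate q →
      ∀ (ι : Type) [Fintype ι] (u H : TentDuality.Space n → EuclideanSpace ℂ ι),
        AEStronglyMeasurable u (volume.restrict (TentDuality.upperHalfSpace n)) →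
        AEStronglyMeasurable H (volume.restrict (TentDuality.upperHalfSpace n)) →
        eLpNorm (TentDuality.modNT u) (ENNReal.ofReal p) volume ≠ ∞ →
        eLpNorm (TentDuality.avgCarleson (TentDuality.tMul H)) (ENNReal.ofReal q) volume ≠ ∞ →
        (∀ j, IntegrableOn (fun X => starRingEnd ℂ (u X j) * H X j)
          (TentDuality.upperHalfSpace n) volume) ∧
        ‖TentDuality.pairing u H‖ₑ
          ≤ C * eLpNorm (TentDuality.modNT u) (ENNReal.ofReal p) volume
              * eLpNorm (TentDuality.avgCarleson (TentDuality.tMul H))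
                  (ENNReal.ofReal q) volume) := by
  refine ⟨fun p q hpq => ⟨(TentDuality.dualConst n q).toNNReal, fun ι _ u hu hD => ?_⟩,
    (TentDuality.pairingConst n).toNNReal, fun p q hpq ι _ u H hu hH hN hC => ?_⟩
  · rw [ENNReal.coe_toNNReal (TentDuality.dualConst_ne_top hpq.symm.lt)]
    exact TentDuality.eLpNorm_modNT_le hn hpq hu hD
  · rw [ENNReal.coe_toNNReal TentDuality.pairingConst_ne_top]
    have hle := TentDuality.lintegral_enorm_mul_enorm_le hn hpq hu hH hN
    have hint := TentDuality.integrableOn_conj_mul hu hH (hle.trans_lt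
      (ENNReal.mul_lt_top (ENNReal.mul_lt_top TentDuality.pairingConst_ne_top.lt_top hN.lt_top)
        hC.lt_top))
    exact ⟨hint, (TentDuality.enorm_pairing_le hint).trans hle⟩
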